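/- Let $\Omega\subset\mathbb{R}^n$ be a domain (a connected open set) with $|\Omega|=1$, and let $1\le p<\infty$. For a measurable function $h$ on $\Omega$ let $h^{*}(s)=\inf\{\lambda\ge 0: |\{x\in\Omega:|h(x)|>\lambda\}|\le s\}$ be its decreasing rearrangement and $h^{**}(t)=\frac1t\int_0^t h^{*}(s)\,ds$. Assume that the $L^p$ Sobolev–Poincaré inequality holds on $\Omega$: there is a constant $K<\infty$ such that $$\Big(\int_\Omega |f-f_\Omega|^p\,dx\Big)^{1/p}\le K\int_\Omega|\nabla f|\,dx\qquad\text{for all } f\in W^{1,1}(\Omega),\qquad f_\Omega=\frac1{|\Omega|}\int_\Omega f\,dx .$$ Then there is a constant $C>0$ (depending only on $\Omega$ and $p$) such that for each $f\in W^{1,1}(\Omega)$ there exists $r_f\in\mathbb{R}$ which is a median of $f$, i.e. $|\{f\ge r_f\}|\ge\frac12$ and $|\{f\le r_f\}|\ge\frac12$, with the following properties. The function $(f-r_f)^{*}$ is differentiable almost everywhere on $(0,1)$, and for all $t\in(0,1]$: (a) $$\int_0^t s^{1/p}\big(-(f-r_f)^{*}\big)'(s)\,ds\le C\int_0^t|\nabla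 f|^{*}(s)\,ds;$$ (b) $$t^{\frac1p-1}\big[(f-r_f)^{**}(t)-(f-r_f)^{*}(t)\big]\le \frac{C}{t}\int_0^t|\nabla f|^{*}(s)\,ds;$$ (c) if $p>1$, $$\int_0^t s^{\frac1p-1}\big[(f-r_f)^{**}(s)-(f-r_f)^{*}(s)\big]\,ds\le C\int_0^t|\nabla f|^{*}(s)\,ds.$$ In particular, the integrals on the left of (a) and (c) are finite. -/

import Mathlib

open MeasureTheory Set
open scoped ENNReal NNReal ContDiff

noncomputable section

/-- The (nonincreasing) rearrangement `f^*` of `f` with respect to `μ`: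
`f^*(s) = inf {l ≥ 0 : μ {|f| > l} ≤ s}`. It is used only for `s > 0`. -/
def decRearr {α : Type*} [MeasurableSpace α] (μ : Measure α) (f : α → ℝ) (s : ℝ) : ℝ :=
  sInf {l : ℝ | 0 ≤ l ∧ μ {x | l < |f x|} ≤ ENNReal.ofReal s}

/-- The maximal function `f^{**}(t) = (1/t) ∫_0^t f^*(s) ds` of the rearrangement. -/
def maxRearr {α : Type*} [MeasurableSpace α] (μ : Measure α) (f : α → ℝ) (t : ℝ) : ℝ :=
  t⁻¹ * ∫ s in (0 : ℝ)..t, decRearr μ f s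

/-- `r` is a median of `f` with respect to the probability measure `μ`. -/
def IsMedian {α : Type*} [MeasurableSpace α] (μ : Measure α) (f : α → ℝ) (r : ℝ) : Prop :=
  1 / 2 ≤ μ {x | r ≤ f x} ∧ 1 / 2 ≤ μ {x | f x ≤ r}

/-- `f` belongs to the Sobolev space `W^{1,1}(Ω)` and `g` is (a version of) its weak gradient:
`f` and `g` are integrable on `Ω`, and `∫_Ω f ∂_i φ = -∫_Ω g_i φ` for every coordinate `i` and
every smooth `φ` with compact support contained in `Ω`. -/
structure SobolevW11 {n : ℕ} (Ω : Set (EuclideanSpace ℝ (Fin n)))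
    (f : EuclideanSpace ℝ (Fin n) → ℝ)
    (g : EuclideanSpace ℝ (Fin n) → EuclideanSpace ℝ (Fin n)) : Prop where
  integrable_fun : IntegrableOn f Ω
  integrable_grad : IntegrableOn g Ω
  weak_grad : ∀ φ : EuclideanSpace ℝ (Fin n) → ℝ,
    ContDiff ℝ ∞ φ → HasCompactSupport φ → tsupport φ ⊆ Ω →
    ∀ i : Fin n,
      ∫ x in Ω, f x * fderiv ℝ φ x (EuclideanSpace.single i 1) = -∫ x in Ω, g x i * φ x

/-- The `L^p` Sobolev-Poincaré inequality on `Ω`: for some finite constant `K`,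
`(∫_Ω |f - f_Ω|^p)^{1/p} ≤ K ∫_Ω |∇f|` for all `f ∈ W^{1,1}(Ω)`, where `f_Ω` is the average of `f`
over `Ω`. The integrals are `[0, ∞]`-valued, so finiteness of the left side is part of it. -/
def SobolevPoincare {n : ℕ} (Ω : Set (EuclideanSpace ℝ (Fin n))) (p : ℝ) : Prop :=
  ∃ K : ℝ≥0, ∀ (f : EuclideanSpace ℝ (Fin n) → ℝ)
    (g : EuclideanSpace ℝ (Fin n) → EuclideanSpace ℝ (Fin n)), SobolevW11 Ω f g →
    (∫⁻ x in Ω, ‖f x - ⨍ y in Ω, f y‖ₑ ^ p) ^ (1 / p) ≤ K * ∫⁻ x in Ω, ‖g x‖ₑ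

end

/-! ### Distribution functions and decreasing rearrangements. -/

section Rearrangement

open Filter Topology

variable {α : Type*} [MeasurableSpace α] {μ : Measure α} {F : α → ℝ}

/-! Write μ for Lebesgue measure on Ω, F = f - r with r any median of f, D(l) = μ{|F| > l}, and ν =
2K|∇f|μ. The Sobolev–Poincaré inequality enters only through truncations: for 0 ≤ a < b, (b - a)
D(b)^{1/p} ≤ ν{a < |F| ≤ b} (`SobolevW11.weakTruncationBound`). Indeed, cutting f off between two
levels leaves the gradient ∇f restricted to that layer (`SobolevW11.clamp`, by mollification and a
chain rule), and since r is a median the cut-off function is constant on at least half of Ω, so its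
unknown mean costs only a factor 2.

The rest is measure theory. Letting b - a tend to 0 gives D(l)^{1/p} ≤ -(d/dl) ν{|F| > l} for a.e.
l, and integrating above F*(t) gives ∫_{F*(t)}^∞ D^{1/p} ≤ ν{|F| > F*(t)}
(`WeakTruncationBound.lintegral_rpow_le`). As μ{|F| > F*(t)} ≤ t, Hardy–Littlewood bounds the right
side by 2K ∫_0^t |∇f|*.

Now t(F** - F*)(t) = ∫_{F*(t)}^∞ D, and D ≤ t^{1-1/p} D^{1/p} above the level F*(t); this is (b).
Tonelli applied to the same formula gives (c). For (a), the truncation bound is used between the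
levels F*(s') and F*(s) and differentiated in s. Both differentiations concern monotone functions M,
for which ∫ M' ≤ M(b) - M(a) holds without absolute continuity. -/

lemma measure_lt_le_of_forall_gt {l : ℝ} {c : ℝ≥0∞}
    (h : ∀ l' > l, μ {x | l' < F x} ≤ c) : μ {x | l < F x} ≤ c := by
  have hU : {x | l < F x} = ⋃ n : ℕ, {x | l + 1 / ((n : ℝ) + 1) < F x} := by
    ext x
    simp only [mem_ofPred_eq, mem_iUnion]
    constructor
    · intro hx
      obtain ⟨n, hn⟩ := exists_nat_one_div_lt (sub_pos.2 hx)
      exact ⟨n, by linarith⟩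
    · rintro ⟨n, hn⟩
      have : (0 : ℝ) < 1 / ((n : ℝ) + 1) := by positivity
      linarith
  rw [hU, Monotone.measure_iUnion]
  · refine iSup_le fun n => h _ ?_
    have : (0 : ℝ) < 1 / ((n : ℝ) + 1) := by positivity
    linarith
  · intro m n hmn x hx
    have : 1 / ((n : ℝ) + 1) ≤ 1 / ((m : ℝ) + 1) := by gcongr
    simp only [mem_ofPred_eq] at hx ⊢
    linarith

lemma exists_measure_lt_le [IsFiniteMeasure μ] (hF : AEMeasurable F μ) {c : ℝ≥0∞} (hc : 0 < c) :
    ∃ l : ℝ, 0 ≤ l ∧ μ {x | l < F x} ≤ c := by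
  have ht : Tendsto (fun n : ℕ => μ {x | (n : ℝ) < F x}) atTop
      (𝓝 (μ (⋂ n : ℕ, {x | (n : ℝ) < F x}))) := by
    refine tendsto_measure_iInter_atTop (fun n => nullMeasurableSet_lt aemeasurable_const hF)
      (fun m n hmn x hx => ?_) ⟨0, measure_ne_top _ _⟩
    have : (m : ℝ) ≤ n := by exact_mod_cast hmn
    exact lt_of_le_of_lt this hx
  have he : (⋂ n : ℕ, {x | (n : ℝ) < F x}) = ∅ := by
    ext x
    simp only [mem_iInter, mem_ofPred_eq, mem_empty_iff_false, iff_false, not_forall, not_lt]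
    exact exists_nat_ge (F x)
  rw [he, measure_empty] at ht
  obtain ⟨n, hn⟩ := (ht.eventually (gt_mem_nhds hc)).exists
  exact ⟨n, n.cast_nonneg, hn.le⟩

lemma decRearr_nonneg (s : ℝ) : 0 ≤ decRearr μ F s :=
  Real.sInf_nonneg fun _ hl => hl.1

/-- The infimum is attained because the distribution function is right-continuous. For s > 0 the
competing set is nonempty since μ is finite; at s = 0 it can be empty. All later facts about the
rearrangement come from this Galois connection. -/
lemma decRearr_le_iff [IsFiniteMeasure μ] (hF : AEMeasurable F μ) {s l : ℝ} (hs : 0 < s)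
    (hl : 0 ≤ l) : decRearr μ F s ≤ l ↔ μ {x | l < |F x|} ≤ ENNReal.ofReal s := by
  have hne : {l : ℝ | 0 ≤ l ∧ μ {x | l < |F x|} ≤ ENNReal.ofReal s}.Nonempty :=
    exists_measure_lt_le hF.abs (ENNReal.ofReal_pos.2 hs)
  constructor
  · intro h
    refine measure_lt_le_of_forall_gt fun l' hl' => ?_
    obtain ⟨m, ⟨_, hm⟩, hml⟩ := exists_lt_of_csInf_lt hne (lt_of_le_of_lt h hl')
    exact (measure_mono fun x hx => hml.trans hx).trans hm
  · exact fun h => csInf_le ⟨0, fun _ hx => hx.1⟩ ⟨hl, h⟩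

lemma lt_decRearr_iff [IsFiniteMeasure μ] (hF : AEMeasurable F μ) {s l : ℝ} (hs : 0 < s)
    (hl : 0 ≤ l) : l < decRearr μ F s ↔ ENNReal.ofReal s < μ {x | l < |F x|} := by
  simpa using (decRearr_le_iff hF hs hl).not

lemma measure_decRearr_lt_le [IsFiniteMeasure μ] (hF : AEMeasurable F μ) {s : ℝ} (hs : 0 < s) :
    μ {x | decRearr μ F s < |F x|} ≤ ENNReal.ofReal s :=
  (decRearr_le_iff hF hs (decRearr_nonneg s)).1 le_rfl

lemma decRearr_antitoneOn [IsFiniteMeasure μ] (hF : AEMeasurable F μ) :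
    AntitoneOn (decRearr μ F) (Ioi 0) := fun s hs _ ht hst =>
  (decRearr_le_iff hF ht (decRearr_nonneg s)).2
    ((measure_decRearr_lt_le hF hs).trans (ENNReal.ofReal_le_ofReal hst))

lemma aemeasurable_decRearr [IsFiniteMeasure μ] (hF : AEMeasurable F μ) (s : ℝ) :
    AEMeasurable (decRearr μ F) (volume.restrict (Ioc 0 s)) :=
  aemeasurable_restrict_of_antitoneOn measurableSet_Ioc
    ((decRearr_antitoneOn hF).mono fun _ hx => hx.1)

lemma setLIntegral_Ioi_comp_add_left (c : ℝ) (H : ℝ → ℝ≥0∞) :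
    ∫⁻ t in Ioi 0, H (c + t) = ∫⁻ l in Ioi c, H l := by
  rw [← lintegral_indicator measurableSet_Ioi, ← lintegral_indicator measurableSet_Ioi,
    ← lintegral_add_left_eq_self (indicator (Ioi c) H) c]
  congr with t
  simp [indicator]

/-- Layer cake formula for the rearrangement. -/
lemma lintegral_decRearr_sub [IsFiniteMeasure μ] (hF : AEMeasurable F μ) {s c : ℝ}
    (hc : 0 ≤ c) :
    ∫⁻ u in Ioc 0 s, ENNReal.ofReal (decRearr μ F u - c)
      = ∫⁻ l in Ioi c, min (ENNReal.ofReal s) (μ {x | l < |F x|}) := by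
  have h1 : ∀ u, ENNReal.ofReal (decRearr μ F u - c)
      = ENNReal.ofReal (max (decRearr μ F u - c) 0) := fun u => by simp
  simp_rw [h1]
  rw [lintegral_eq_lintegral_meas_lt (f := fun u => max (decRearr μ F u - c) 0) _
      (ae_of_all _ fun u => le_max_right _ _)
    (((aemeasurable_decRearr hF s).sub_const c).max aemeasurable_const),
    ← setLIntegral_Ioi_comp_add_left c (fun l => min (ENNReal.ofReal s) (μ {x | l < |F x|}))]
  refine setLIntegral_congr_fun measurableSet_Ioi fun t (ht : 0 < t) => ?_
  set d := μ {x | c + t < |F x|} with hd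
  have hdt : d ≠ ⊤ := measure_ne_top _ _
  rw [Measure.restrict_apply' measurableSet_Ioc]
  -- Superlevel sets of the rearrangement are initial intervals, whose length is the measure of the
  -- corresponding superlevel set of |F|, capped at s.
  have hset : {u | t < max (decRearr μ F u - c) 0} ∩ Ioc 0 s = Iio d.toReal ∩ Ioc 0 s := by
    ext u
    simp only [mem_inter_iff, mem_ofPred_eq, mem_Iio, and_congr_left_iff]
    intro hu
    have h2 := lt_decRearr_iff hF hu.1 (add_nonneg hc ht.le)
    rw [← hd, ← ENNReal.ofReal_toReal hdt,
      ENNReal.ofReal_lt_ofReal_iff_of_nonneg hu.1.le] at h2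
    rw [← h2, lt_max_iff]
    constructor
    · rintro (h | h) <;> linarith
    · intro h; left; linarith
  rw [hset]
  rcases le_or_gt d.toReal s with h | h
  · have : Iio d.toReal ∩ Ioc 0 s = Ioo 0 d.toReal := by
      ext u; simp only [mem_inter_iff, mem_Iio, mem_Ioc, mem_Ioo]
      constructor
      · rintro ⟨a, b, _⟩; exact ⟨b, a⟩
      · rintro ⟨a, b⟩; exact ⟨b, a, by linarith⟩
    rw [this, Real.volume_Ioo, sub_zero, ENNReal.ofReal_toReal hdt, min_eq_right]
    exact (ENNReal.le_ofReal_iff_toReal_le hdt (ENNReal.toReal_nonneg.trans h)).2 h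
  · have : Iio d.toReal ∩ Ioc 0 s = Ioc 0 s := by
      ext u; simp only [mem_inter_iff, mem_Iio, mem_Ioc]
      constructor
      · rintro ⟨a, b, c⟩; exact ⟨b, c⟩
      · rintro ⟨a, b⟩; exact ⟨by linarith, a, b⟩
    rw [this, Real.volume_Ioc, sub_zero, min_eq_left]
    exact ENNReal.ofReal_le_of_le_toReal h.le

lemma lintegral_decRearr [IsFiniteMeasure μ] (hF : AEMeasurable F μ) (s : ℝ) :
    ∫⁻ u in Ioc 0 s, ENNReal.ofReal (decRearr μ F u)
      = ∫⁻ l in Ioi 0, min (ENNReal.ofReal s) (μ {x | l < |F x|}) := by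
  simpa using lintegral_decRearr_sub hF (s := s) le_rfl

/-- Hardy–Littlewood: the integral over a set is at most that of the rearrangement. -/
lemma setLIntegral_le_lintegral_decRearr [IsFiniteMeasure μ] (hF : AEMeasurable F μ) {s : ℝ}
    {E : Set α} (hE : μ E ≤ ENNReal.ofReal s) :
    ∫⁻ x in E, ENNReal.ofReal |F x| ∂μ ≤ ∫⁻ u in Ioc 0 s, ENNReal.ofReal (decRearr μ F u) := by
  rw [lintegral_decRearr hF, lintegral_eq_lintegral_meas_lt _ (ae_of_all _ fun x => abs_nonneg _)
    hF.abs.restrict]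
  refine lintegral_mono fun l => le_min ?_ (Measure.restrict_le_self _)
  exact (measure_mono (subset_univ _)).trans (by simpa using hE)

lemma integrableOn_decRearr [IsFiniteMeasure μ] (hF : Integrable F μ) (s : ℝ) :
    IntegrableOn (decRearr μ F) (Ioc 0 s) := by
  have hm := hF.aestronglyMeasurable.aemeasurable
  refine ⟨(aemeasurable_decRearr hm s).aestronglyMeasurable, ?_⟩
  rw [hasFiniteIntegral_iff_ofReal (ae_of_all _ fun u => decRearr_nonneg u),
    lintegral_decRearr hm]
  refine lt_of_le_of_lt (lintegral_mono fun l => min_le_right _ _) ?_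
  rw [← lintegral_eq_lintegral_meas_lt _ (ae_of_all _ fun x => abs_nonneg _) hm.abs]
  exact (hasFiniteIntegral_iff_ofReal (ae_of_all _ fun x => abs_nonneg _)).1 hF.abs.2

lemma ofReal_integral_decRearr [IsFiniteMeasure μ] (hF : Integrable F μ) {s : ℝ} (hs : 0 ≤ s) :
    ENNReal.ofReal (∫ u in (0 : ℝ)..s, decRearr μ F u)
      = ∫⁻ u in Ioc 0 s, ENNReal.ofReal (decRearr μ F u) := by
  rw [intervalIntegral.integral_of_le hs,
    ofReal_integral_eq_lintegral_ofReal (integrableOn_decRearr hF s)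
      (ae_of_all _ fun u => decRearr_nonneg u)]

/-- The quantity `s (F^{**}(s) - F^*(s))` in terms of the distribution function. -/
lemma ofReal_mul_maxRearr_sub [IsFiniteMeasure μ] (hF : Integrable F μ) {s : ℝ} (hs : 0 < s) :
    ENNReal.ofReal (s * (maxRearr μ F s - decRearr μ F s))
      = ∫⁻ l in Ioi (decRearr μ F s), μ {x | l < |F x|} := by
  have hm := hF.aestronglyMeasurable.aemeasurable
  have hi := integrableOn_decRearr hF s
  have h1 : s * (maxRearr μ F s - decRearr μ F s)
      = ∫ u in Ioc 0 s, (decRearr μ F u - decRearr μ F s) := by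
    rw [integral_sub hi (by simp), maxRearr, intervalIntegral.integral_of_le hs.le, mul_sub,
      mul_inv_cancel_left₀ hs.ne']
    simp [hs.le]
  rw [h1, ofReal_integral_eq_lintegral_ofReal
    (f := fun u => decRearr μ F u - decRearr μ F s) (hi.sub (by simp)), lintegral_decRearr_sub hm
    (decRearr_nonneg s)]
  -- Above the level F*(s) the distribution function is at most s, so the cap in the layer cake
  -- formula is inactive.
  · refine setLIntegral_congr_fun measurableSet_Ioi fun l hl => min_eq_right ?_
    refine le_trans (measure_mono fun x hx => ?_) (measure_decRearr_lt_le hm hs)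
    exact lt_trans (mem_Ioi.1 hl) hx
  · filter_upwards [ae_restrict_mem measurableSet_Ioc] with u hu
    exact sub_nonneg.2 (decRearr_antitoneOn hm hu.1 hs hu.2)

lemma decRearr_le_maxRearr [IsFiniteMeasure μ] (hF : Integrable F μ) {s : ℝ} (hs : 0 < s) :
    decRearr μ F s ≤ maxRearr μ F s := by
  have hm := hF.aestronglyMeasurable.aemeasurable
  have h : ∫ _ in Ioc 0 s, decRearr μ F s ≤ ∫ u in Ioc 0 s, decRearr μ F u :=
    setIntegral_mono_on (by simp) (integrableOn_decRearr hF s) measurableSet_Ioc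
      fun u hu => decRearr_antitoneOn hm hu.1 hs hu.2
  rw [maxRearr, intervalIntegral.integral_of_le hs.le, ← div_eq_inv_mul, le_div_iff₀ hs]
  simpa [hs.le, mul_comm] using h

end Rearrangement

/-! ### Integrating a pointwise lower bound on the derivative of a monotone function. -/

section MonotoneDeriv

open Filter Topology

/-- A monotone function is differentiable a.e. and the integral of its derivative never exceeds its
increment; jumps and singular parts only help in this direction. -/
lemma MonotoneOn.lintegral_ofReal_le_of_le_deriv {M w : ℝ → ℝ} {a b : ℝ} (hab : a ≤ b)
    (hM : MonotoneOn M (Icc a b))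
    (hw : ∀ᵐ x, x ∈ Ioo a b → DifferentiableAt ℝ M x → w x ≤ deriv M x) :
    ∫⁻ x in Ioc a b, ENNReal.ofReal (w x) ≤ ENNReal.ofReal (M b - M a) := by
  rw [← uIcc_of_le hab] at hM
  have h1 := hM.intervalIntegral_deriv_mem_uIcc
  have h2 := hM.intervalIntegrable_deriv
  rw [uIcc_of_le hab] at hM
  rw [uIcc_of_le (sub_nonneg.2 (hM (left_mem_Icc.2 hab) (right_mem_Icc.2 hab) hab))] at h1
  rw [intervalIntegral.integral_of_le hab] at h1
  rw [intervalIntegrable_iff_integrableOn_Ioc_of_le hab] at h2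
  have hd : ∀ᵐ x, x ∈ Ioo a b → DifferentiableAt ℝ M x := by
    filter_upwards [hM.ae_differentiableWithinAt_of_mem] with x hx hxI
    exact (hx (Ioo_subset_Icc_self hxI)).differentiableAt (Icc_mem_nhds hxI.1 hxI.2)
  calc ∫⁻ x in Ioc a b, ENNReal.ofReal (w x)
      ≤ ∫⁻ x in Ioc a b, ENNReal.ofReal (deriv M x) := by
        rw [← restrict_Ioo_eq_restrict_Ioc]
        refine lintegral_mono_ae ?_
        refine (ae_restrict_iff' measurableSet_Ioo).2 ?_
        filter_upwards [hd, hw] with x h3 h4 hx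
        exact ENNReal.ofReal_le_ofReal (h4 hx (h3 hx))
    _ = ENNReal.ofReal (∫ x in Ioc a b, deriv M x) := by
        refine (ofReal_integral_eq_lintegral_ofReal h2 ?_).symm
        rw [← restrict_Ioo_eq_restrict_Ioc]
        refine (ae_restrict_iff' measurableSet_Ioo).2 ?_
        refine ae_of_all _ fun x hx => ?_
        rw [← derivWithin_of_mem_nhds (Icc_mem_nhds hx.1 hx.2)]
        exact hM.derivWithin_nonneg
    _ ≤ _ := ENNReal.ofReal_le_ofReal h1.2

end MonotoneDeriv

/-! ### Consequences of the truncation bound for rearrangements. -/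

section TruncationBound

open Filter Topology

variable {α : Type*} [MeasurableSpace α] {μ ν : Measure α} {F : α → ℝ} {p : ℝ}

/-- `ν` controls the truncations of `|F|` in the weak `L^p` sense. -/
def WeakTruncationBound (μ ν : Measure α) (F : α → ℝ) (p : ℝ) : Prop :=
  ∀ a b : ℝ, 0 ≤ a → a < b →
    ENNReal.ofReal (b - a) * μ {x | b < |F x|} ^ (1 / p) ≤ ν {x | a < |F x| ∧ |F x| ≤ b}

lemma measure_lt_add_measure_lt_le (hF : AEMeasurable F ν) {a b : ℝ} (hab : a ≤ b) :
    ν {x | a < |F x| ∧ |F x| ≤ b} + ν {x | b < |F x|} = ν {x | a < |F x|} := by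
  have h := measure_inter_add_sdiff₀ {x | a < |F x|}
    (nullMeasurableSet_lt aemeasurable_const hF.abs : NullMeasurableSet {x | b < |F x|} ν)
  rw [← h, add_comm]
  congr 2
  · ext x
    simp only [mem_ofPred_eq, mem_inter_iff]
    exact ⟨fun h => ⟨hab.trans_lt h, h⟩, fun h => h.2⟩
  · ext x
    simp

lemma WeakTruncationBound.le_measureReal [IsFiniteMeasure μ] [IsFiniteMeasure ν]
    (h : WeakTruncationBound μ ν F p) {a b : ℝ} (ha : 0 ≤ a) (hab : a < b) :
    (b - a) * μ.real {x | b < |F x|} ^ (1 / p) ≤ ν.real {x | a < |F x| ∧ |F x| ≤ b} := by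
  have h1 := ENNReal.toReal_mono (measure_ne_top _ _) (h a b ha hab)
  rwa [ENNReal.toReal_mul, ENNReal.toReal_ofReal (sub_nonneg.2 hab.le),
    ← ENNReal.toReal_rpow] at h1

lemma measureReal_lt_eq_add [IsFiniteMeasure ν] (hF : AEMeasurable F ν) {a b : ℝ}
    (hab : a ≤ b) :
    ν.real {x | a < |F x|} = ν.real {x | a < |F x| ∧ |F x| ≤ b} + ν.real {x | b < |F x|} := by
  rw [Measure.real, ← measure_lt_add_measure_lt_le hF hab,
    ENNReal.toReal_add (measure_ne_top _ _) (measure_ne_top _ _)]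
  rfl

/-- The truncation bound, divided by b - a, says that difference quotients of l ↦ -ν{|F| > l}
dominate μ{|F| > b}^{1/p}; this monotone function is then integrated over [a, b] and b sent to
infinity. -/
lemma WeakTruncationBound.lintegral_rpow_le [IsFiniteMeasure μ] [IsFiniteMeasure ν]
    (h : WeakTruncationBound μ ν F p) (hp : 0 < p) (hF : AEMeasurable F ν) {a : ℝ}
    (ha : 0 ≤ a) :
    ∫⁻ l in Ioi a, μ {x | l < |F x|} ^ (1 / p) ≤ ν {x | a < |F x|} := by
  have key : ∀ b, a ≤ b →
      ∫⁻ l in Ioc a b, μ {x | l < |F x|} ^ (1 / p) ≤ ν {x | a < |F x|} := by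
    intro b hab
    have hmono : Monotone fun l => -ν.real {x | l < |F x|} := fun l l' hl =>
      neg_le_neg (measureReal_mono fun x hx => lt_of_le_of_lt hl hx)
    have h1 := (hmono.monotoneOn (Icc a b)).lintegral_ofReal_le_of_le_deriv
      (w := fun l => μ.real {x | l < |F x|} ^ (1 / p)) hab ?_
    · calc ∫⁻ l in Ioc a b, μ {x | l < |F x|} ^ (1 / p)
          = ∫⁻ l in Ioc a b, ENNReal.ofReal (μ.real {x | l < |F x|} ^ (1 / p)) := by
            congr with l
            rw [← ENNReal.ofReal_rpow_of_nonneg measureReal_nonneg (by positivity),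
              ofReal_measureReal]
        _ ≤ _ := h1
        _ ≤ ENNReal.ofReal (ν.real {x | a < |F x|}) :=
            ENNReal.ofReal_le_ofReal (by linarith [measureReal_nonneg (μ := ν) (s := {x | b < |F x|})])
        _ = _ := ofReal_measureReal
    · refine ae_of_all _ fun l hl hd => ?_
      -- Slopes are taken from the left: with upper level l fixed, the truncation bound involves
      -- exactly μ{|F| > l}, so no continuity in l is needed.
      have ht := hd.hasDerivAt.tendsto_slope.mono_left
        (nhdsWithin_mono l (show Iio l ⊆ {l}ᶜ from fun y hy => (mem_Iio.1 hy).ne))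
      refine ge_of_tendsto ht ?_
      filter_upwards [Ioo_mem_nhdsLT hl.1] with y hy
      have h2 := h.le_measureReal (ha.trans hy.1.le) hy.2
      have h3 := measureReal_lt_eq_add hF hy.2.le
      rw [slope_comm, slope_def_field, le_div_iff₀ (sub_pos.2 hy.2)]
      linarith
  have hU : Ioi a = ⋃ n : ℕ, Ioc a (a + n) := by
    ext x
    simp only [mem_Ioi, mem_iUnion, mem_Ioc]
    refine ⟨fun hx => ?_, fun ⟨n, hn⟩ => hn.1⟩
    obtain ⟨n, hn⟩ := exists_nat_ge (x - a)
    exact ⟨n, hx, by linarith⟩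
  rw [hU, setLIntegral_iUnion_of_directed]
  · exact iSup_le fun n => key _ (by simp)
  · refine Monotone.directed_le fun m n hmn => Ioc_subset_Ioc_right ?_
    have : (m : ℝ) ≤ n := by exact_mod_cast hmn
    linarith

lemma WeakTruncationBound.mul_maxRearr_sub_le [IsFiniteMeasure μ] [IsFiniteMeasure ν]
    (h : WeakTruncationBound μ ν F p) (hp : 1 ≤ p) (hF : Integrable F μ) (hFν : AEMeasurable F ν)
    {s : ℝ} (hs : 0 < s) :
    ENNReal.ofReal (s * (maxRearr μ F s - decRearr μ F s))
      ≤ ENNReal.ofReal (s ^ (1 - 1 / p)) * ν {x | decRearr μ F s < |F x|} := by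
  have hm := hF.aestronglyMeasurable.aemeasurable
  have hp0 : 0 < p := by linarith
  have hp1 : 0 ≤ 1 - 1 / p := by rw [sub_nonneg, div_le_one hp0]; exact hp
  rw [ofReal_mul_maxRearr_sub hF hs]
  calc ∫⁻ l in Ioi (decRearr μ F s), μ {x | l < |F x|}
      ≤ ∫⁻ l in Ioi (decRearr μ F s), ENNReal.ofReal (s ^ (1 - 1 / p)) *
          μ {x | l < |F x|} ^ (1 / p) := by
        refine setLIntegral_mono' measurableSet_Ioi fun l hl => ?_
        have hle : μ {x | l < |F x|} ≤ ENNReal.ofReal s := by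
          refine le_trans (measure_mono fun x hx => ?_) (measure_decRearr_lt_le hm hs)
          exact lt_trans (mem_Ioi.1 hl) hx
        calc μ {x | l < |F x|}
            = μ {x | l < |F x|} ^ (1 - 1 / p) * μ {x | l < |F x|} ^ (1 / p) := by
              rw [← ENNReal.rpow_add_of_nonneg _ _ hp1 (by positivity)]; simp
          _ ≤ _ := by
              rw [← ENNReal.ofReal_rpow_of_nonneg hs.le hp1]
              gcongr
    _ = ENNReal.ofReal (s ^ (1 - 1 / p)) *
          ∫⁻ l in Ioi (decRearr μ F s), μ {x | l < |F x|} ^ (1 / p) :=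
        lintegral_const_mul' _ _ ENNReal.ofReal_ne_top
    _ ≤ _ := by gcongr; exact h.lintegral_rpow_le hp0 hFν (decRearr_nonneg s)

lemma measurable_measure_lt (μ : Measure α) (F : α → ℝ) :
    Measurable fun l : ℝ => μ {x | l < F x} :=
  Antitone.measurable fun _ _ h => measure_mono fun _ hx => lt_of_le_of_lt h hx

/-- This is the inner integral after Tonelli: the constraint s ≥ d cuts off the singularity, and
∫_d^∞ s^q ds = d^{q+1}/(-q-1). For d = 0 the integral may be infinite, but the factor d kills it. -/
lemma mul_lintegral_rpow_le {q t : ℝ} (hq : q < -1) {d : ℝ≥0∞} (hd : d ≠ ⊤) :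
    d * ∫⁻ s in Ioc 0 t, (if d ≤ ENNReal.ofReal s then ENNReal.ofReal (s ^ q) else 0)
      ≤ ENNReal.ofReal (1 / (-q - 1)) * d ^ (q + 2) := by
  rcases eq_or_ne d 0 with rfl | hd0
  · simp
  have hr : 0 < d.toReal := ENNReal.toReal_pos hd0 hd
  set r := d.toReal with hrd
  have hdr : d = ENNReal.ofReal r := (ENNReal.ofReal_toReal hd).symm
  have h1 : ∫⁻ s in Ioc 0 t, (if d ≤ ENNReal.ofReal s then ENNReal.ofReal (s ^ q) else 0)
      ≤ ENNReal.ofReal (1 / (-q - 1) * r ^ (q + 1)) := by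
    calc ∫⁻ s in Ioc 0 t, (if d ≤ ENNReal.ofReal s then ENNReal.ofReal (s ^ q) else 0)
        ≤ ∫⁻ s, (Ici r).indicator (fun s => ENNReal.ofReal (s ^ q)) s := by
          refine (setLIntegral_mono' measurableSet_Ioc fun s hs => ?_).trans
            (setLIntegral_le_lintegral _ _)
          have hiff : d ≤ ENNReal.ofReal s ↔ s ∈ Ici r := by
            rw [hdr, ENNReal.ofReal_le_ofReal_iff hs.1.le, mem_Ici]
          rw [indicator_apply, if_congr hiff rfl rfl]
      _ = ∫⁻ s in Ioi r, ENNReal.ofReal (s ^ q) := by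
          rw [lintegral_indicator measurableSet_Ici, restrict_Ioi_eq_restrict_Ici]
      _ = ENNReal.ofReal (∫ s in Ioi r, s ^ q) := by
          refine (ofReal_integral_eq_lintegral_ofReal (integrableOn_Ioi_rpow_of_lt hq hr) ?_).symm
          refine (ae_restrict_iff' measurableSet_Ioi).2 (ae_of_all _ fun s hs => ?_)
          exact Real.rpow_nonneg (hr.le.trans (mem_Ioi.1 hs).le) _
      _ = _ := by
          rw [integral_Ioi_rpow_of_lt hq hr]
          congr 1
          rw [neg_div, ← div_neg, div_mul_eq_mul_div, one_mul]
          congr 1; ring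
  calc _ ≤ d * ENNReal.ofReal (1 / (-q - 1) * r ^ (q + 1)) := by gcongr
    _ = ENNReal.ofReal (1 / (-q - 1) * r ^ (q + 2)) := by
        have e : r ^ (q + 2) = r ^ (q + 1) * r := by
          rw [← Real.rpow_add_one hr.ne']; congr 1; ring
        rw [hdr, ← ENNReal.ofReal_mul hr.le, e]
        congr 1; ring
    _ = _ := by
        rw [ENNReal.ofReal_mul (by apply one_div_nonneg.2; linarith), hdr,
          ENNReal.ofReal_rpow_of_pos hr]

lemma WeakTruncationBound.lintegral_rpow_mul_maxRearr_sub_le [IsFiniteMeasure μ]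
    [IsFiniteMeasure ν] (h : WeakTruncationBound μ ν F p) (hp : 1 < p) (hF : Integrable F μ)
    (hFν : AEMeasurable F ν) {t : ℝ} (ht : 0 < t) :
    ∫⁻ s in Ioc 0 t, ENNReal.ofReal (s ^ (1 / p - 1) * (maxRearr μ F s - decRearr μ F s))
      ≤ ENNReal.ofReal (p / (p - 1)) * ν {x | decRearr μ F t < |F x|} := by
  have hm := hF.aestronglyMeasurable.aemeasurable
  have hp0 : 0 < p := by linarith
  set D : ℝ → ℝ≥0∞ := fun l => μ {x | l < |F x|} with hD
  have hDm : Measurable D := measurable_measure_lt μ _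
  -- The weight s^{1/p-1} loses one more power because the level integral represents s(F** - F*).
  -- The hypothesis 1 < p is exactly q < -1.
  set q : ℝ := 1 / p - 2 with hq
  have hq1 : q < -1 := by
    have : 1 / p < 1 := by rw [div_lt_one hp0]; exact hp
    linarith
  calc ∫⁻ s in Ioc 0 t, ENNReal.ofReal (s ^ (1 / p - 1) * (maxRearr μ F s - decRearr μ F s))
      -- The range of l is enlarged to one independent of s, while the `if` retains the constraint
      -- D(l) ≤ s that holds above F*(s).
      ≤ ∫⁻ s in Ioc 0 t, ∫⁻ l in Ioi (decRearr μ F t),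
          D l * (if D l ≤ ENNReal.ofReal s then ENNReal.ofReal (s ^ q) else 0) := by
        refine setLIntegral_mono' measurableSet_Ioc fun s hs => ?_
        have e : s ^ (1 / p - 1) * (maxRearr μ F s - decRearr μ F s)
            = s ^ q * (s * (maxRearr μ F s - decRearr μ F s)) := by
          rw [← mul_assoc, ← Real.rpow_add_one hs.1.ne']
          congr 2; ring
        rw [e, ENNReal.ofReal_mul (Real.rpow_nonneg hs.1.le _), ofReal_mul_maxRearr_sub hF hs.1,
          ← lintegral_const_mul' _ _ ENNReal.ofReal_ne_top]
        have hsub : Ioi (decRearr μ F s) ⊆ Ioi (decRearr μ F t) :=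
          Ioi_subset_Ioi (decRearr_antitoneOn hm hs.1 ht hs.2)
        refine le_trans (setLIntegral_mono' measurableSet_Ioi fun l hl => ?_)
          (lintegral_mono_set hsub)
        have hle : D l ≤ ENNReal.ofReal s := by
          refine le_trans (measure_mono fun x hx => ?_) (measure_decRearr_lt_le hm hs.1)
          exact lt_trans (mem_Ioi.1 hl) hx
        rw [if_pos hle, mul_comm]
    _ = ∫⁻ l in Ioi (decRearr μ F t), ∫⁻ s in Ioc 0 t,
          D l * (if D l ≤ ENNReal.ofReal s then ENNReal.ofReal (s ^ q) else 0) := by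
        refine lintegral_lintegral_swap (Measurable.aemeasurable ?_)
        refine (hDm.comp measurable_snd).mul (Measurable.ite ?_ ?_ measurable_const)
        · exact measurableSet_le (hDm.comp measurable_snd)
            (ENNReal.measurable_ofReal.comp measurable_fst)
        · exact ((measurable_id.pow_const q).comp measurable_fst).ennreal_ofReal
    _ ≤ ∫⁻ l in Ioi (decRearr μ F t), ENNReal.ofReal (p / (p - 1)) * D l ^ (1 / p) := by
        refine lintegral_mono fun l => ?_
        beta_reduce
        rw [lintegral_const_mul' _ _ (measure_ne_top _ _)]
        refine (mul_lintegral_rpow_le hq1 (measure_ne_top _ _)).trans (le_of_eq ?_)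
        have e1 : 1 / (-q - 1) = p / (p - 1) := by
          have : p - 1 ≠ 0 := by linarith
          have e2 : -q - 1 = (p - 1) / p := by rw [hq]; field_simp; ring
          rw [e2, one_div_div]
        rw [e1, show q + 2 = 1 / p by rw [hq]; ring]
    _ = ENNReal.ofReal (p / (p - 1)) * ∫⁻ l in Ioi (decRearr μ F t), D l ^ (1 / p) :=
        lintegral_const_mul' _ _ ENNReal.ofReal_ne_top
    _ ≤ _ := by gcongr; exact h.lintegral_rpow_le hp0 hFν (decRearr_nonneg t)

lemma ae_differentiableAt_decRearr [IsFiniteMeasure μ] (hF : AEMeasurable F μ) (t : ℝ) :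
    ∀ᵐ s, s ∈ Ioo 0 t → DifferentiableAt ℝ (decRearr μ F) s := by
  have h := ((decRearr_antitoneOn hF).mono (show Ioo 0 t ⊆ Ioi 0 from fun _ hx => hx.1)).neg
  filter_upwards [h.ae_differentiableWithinAt_of_mem] with s hs hst
  have := (hs hst).differentiableAt (Ioo_mem_nhds hst.1 hst.2)
  simpa using this.neg

lemma deriv_decRearr_nonpos [IsFiniteMeasure μ] (hF : AEMeasurable F μ) {s : ℝ} (hs : 0 < s) :
    deriv (decRearr μ F) s ≤ 0 := by
  rw [← derivWithin_of_mem_nhds (Ioi_mem_nhds hs)]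
  exact (decRearr_antitoneOn hF).derivWithin_nonpos

/-- At the level F*(s) itself the superlevel set may have measure below s, but at every level y <
F*(s) it exceeds s. The truncation bound is applied between F*(s') and such y, and y increases to
F*(s). -/
lemma WeakTruncationBound.rpow_mul_sub_le [IsFiniteMeasure μ] [IsFiniteMeasure ν]
    (h : WeakTruncationBound μ ν F p) (hp : 0 < p) (hF : AEMeasurable F μ)
    (hFν : AEMeasurable F ν) {s s' : ℝ} (hs : 0 < s) (hss : s ≤ s') :
    s ^ (1 / p) * (decRearr μ F s - decRearr μ F s')
      ≤ ν.real {x | decRearr μ F s' < |F x|} - ν.real {x | decRearr μ F s < |F x|} := by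
  have hs' := hs.trans_le hss
  rw [measureReal_lt_eq_add hFν (decRearr_antitoneOn hF hs hs' hss), add_sub_cancel_right]
  set a := decRearr μ F s' with ha
  set b := decRearr μ F s with hb
  have ha0 : 0 ≤ a := decRearr_nonneg _
  rcases (decRearr_antitoneOn hF hs hs' hss : a ≤ b).eq_or_lt with hab | hab
  · rw [← ha] at hab
    rw [← hb] at hab
    rw [hab, sub_self, mul_zero]; exact measureReal_nonneg
  have ht : Tendsto (fun y => s ^ (1 / p) * (y - a)) (𝓝[<] b) (𝓝 (s ^ (1 / p) * (b - a))) :=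
    (Continuous.tendsto (by fun_prop) b).mono_left nhdsWithin_le_nhds
  refine le_of_tendsto ht ?_
  filter_upwards [Ioo_mem_nhdsLT hab] with y hy
  have h1 := h.le_measureReal ha0 hy.1
  have h2 := (lt_decRearr_iff hF hs (ha0.trans hy.1.le)).1 hy.2
  have h3 : s ≤ μ.real {x | y < |F x|} :=
    (ENNReal.ofReal_le_iff_le_toReal (measure_ne_top _ _)).1 h2.le
  calc s ^ (1 / p) * (y - a) ≤ (y - a) * μ.real {x | y < |F x|} ^ (1 / p) := by
        rw [mul_comm]
        have := sub_pos.2 hy.1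
        gcongr
    _ ≤ _ := h1
    _ ≤ _ := by
        refine measureReal_mono fun x hx => ?_
        exact ⟨hx.1, hx.2.trans hy.2.le⟩

lemma WeakTruncationBound.lintegral_rpow_mul_deriv_le [IsFiniteMeasure μ] [IsFiniteMeasure ν]
    (h : WeakTruncationBound μ ν F p) (hp : 0 < p) (hF : AEMeasurable F μ)
    (hFν : AEMeasurable F ν) {t : ℝ} (ht : 0 < t) :
    ∫⁻ s in Ioc 0 t, ENNReal.ofReal (s ^ (1 / p) * -deriv (decRearr μ F) s)
      ≤ ν {x | decRearr μ F t < |F x|} := by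
  -- The value 0 is imposed for s ≤ 0 because `decRearr` is not controlled there; this keeps N
  -- monotone on the closed interval and makes its increment from 0 to t equal to ν{|F| > F*(t)}.
  set N : ℝ → ℝ := fun s => if s ≤ 0 then 0 else ν.real {x | decRearr μ F s < |F x|} with hN
  have hNpos : ∀ s, 0 < s → N s = ν.real {x | decRearr μ F s < |F x|} :=
    fun s hs => if_neg (not_le.2 hs)
  have hmono : Monotone N := by
    intro s s' hss
    rcases le_or_gt s 0 with h0 | h0
    · have : N s = 0 := if_pos h0
      rw [this]
      simp only [hN]
      split_ifs
      · exact le_rfl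
      · exact measureReal_nonneg
    · rw [hNpos s h0, hNpos s' (h0.trans_le hss)]
      exact measureReal_mono fun x hx =>
        lt_of_le_of_lt (decRearr_antitoneOn hF h0 (h0.trans_le hss : 0 < s') hss) hx
  have h1 := (hmono.monotoneOn (Icc 0 t)).lintegral_ofReal_le_of_le_deriv
      (w := fun s => s ^ (1 / p) * -deriv (decRearr μ F) s) ht.le ?_
  · refine h1.trans (le_of_eq ?_)
    rw [hNpos t ht, show N 0 = 0 from if_pos le_rfl, sub_zero, ofReal_measureReal]
  filter_upwards [ae_differentiableAt_decRearr hF t] with s hs hst hd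
  -- With the coefficient s^{1/p} frozen, y ↦ N(y) + s^{1/p} F*(y) has nonnegative slopes to the
  -- right of s.
  have hG := hd.hasDerivAt.add ((hs hst).hasDerivAt.const_mul (s ^ (1 / p)))
  have hsl := hG.tendsto_slope.mono_left
    (nhdsWithin_mono s (show Ioi s ⊆ {s}ᶜ from fun y hy => (mem_Ioi.1 hy).ne'))
  have : 0 ≤ deriv N s + s ^ (1 / p) * deriv (decRearr μ F) s := by
    refine ge_of_tendsto hsl ?_
    filter_upwards [self_mem_nhdsWithin] with y (hy : s < y)
    have h2 := h.rpow_mul_sub_le hp hF hFν hst.1 hy.le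
    rw [slope_def_field]
    refine div_nonneg ?_ (sub_nonneg.2 hy.le)
    simp only [Pi.add_apply, hNpos s hst.1, hNpos y (hst.1.trans hy)]
    linarith
  linarith

end TruncationBound

/-! ### Convergence of mollifiers in L¹ and mollified weak gradients. -/

section Mollification

open Filter Topology ContinuousLinearMap
open scoped Convolution

/-- Scheffé's lemma for sequences of nonnegative functions. -/
lemma tendsto_integral_abs_sub_of_nonneg {X : Type*} [MeasurableSpace X] {μ : Measure X}
    {h : ℕ → X → ℝ} {g : X → ℝ} (hg : Integrable g μ) (hh : ∀ k, Integrable (h k) μ)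
    (hg0 : ∀ x, 0 ≤ g x) (hh0 : ∀ k x, 0 ≤ h k x)
    (hlim : ∀ᵐ x ∂μ, Tendsto (fun k => h k x) atTop (𝓝 (g x)))
    (hint : ∀ k, ∫ x, h k x ∂μ = ∫ x, g x ∂μ) :
    Tendsto (fun k => ∫ x, |h k x - g x| ∂μ) atTop (𝓝 0) := by
  -- Since h ≥ 0, the positive part of g - h is dominated by g. Equal integrals then let it control
  -- all of |h - g| = 2(g - h)⁺ + (h - g).
  have h1 : Tendsto (fun k => ∫ x, max (g x - h k x) 0 ∂μ) atTop (𝓝 (∫ _, (0 : ℝ) ∂μ)) := by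
    refine tendsto_integral_of_dominated_convergence g
      (fun k => (hg.sub (hh k)).pos_part.aestronglyMeasurable) hg (fun k => ae_of_all _ fun x => ?_)
      ?_
    · rw [Real.norm_eq_abs, abs_of_nonneg (le_max_right _ _)]
      exact max_le (by linarith [hh0 k x]) (hg0 x)
    · filter_upwards [hlim] with x hx
      simpa using (hx.const_sub (g x)).max (tendsto_const_nhds (x := (0 : ℝ)))
  have h2 : ∀ k, ∫ x, |h k x - g x| ∂μ = 2 * ∫ x, max (g x - h k x) 0 ∂μ := by
    intro k
    have e : ∀ x, |h k x - g x| = 2 * max (g x - h k x) 0 + (h k x - g x) := by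
      intro x
      rcases le_total (h k x) (g x) with hx | hx
      · rw [abs_of_nonpos (by linarith), max_eq_left (by linarith)]; ring
      · rw [abs_of_nonneg (by linarith), max_eq_right (by linarith)]; ring
    simp_rw [e]
    rw [integral_add (f := fun x => 2 * max (g x - h k x) 0) (g := fun x => h k x - g x)
        ((hg.sub (hh k)).pos_part.const_mul 2) ((hh k).sub hg), integral_const_mul, integral_sub (hh k) hg, hint k]
    ring
  simp_rw [h2]
  simpa using h1.const_mul 2

variable {G : Type*} [NormedAddCommGroup G] [NormedSpace ℝ G] [HasContDiffBump G]
  [MeasurableSpace G] [BorelSpace G] [FiniteDimensional ℝ G] {μ : Measure G} [μ.IsAddHaarMeasure]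

lemma ContDiffBump.integrable_normed_convolution (φ : ContDiffBump (0 : G)) {g : G → ℝ}
    (hg : Integrable g μ) : Integrable (φ.normed μ ⋆[lsmul ℝ ℝ, μ] g) μ :=
  φ.integrable_normed.integrable_convolution _ hg

/-- For nonnegative functions, mollification preserves sign and integral and converges a.e., so
Scheffé applies; the general case splits into positive and negative parts. -/
lemma ContDiffBump.tendsto_integral_abs_normed_convolution_sub {φ : ℕ → ContDiffBump (0 : G)}
    {K : ℝ} (hφ : Tendsto (fun k => (φ k).rOut) atTop (𝓝 0))
    (hK : ∀ᶠ k in atTop, (φ k).rOut ≤ K * (φ k).rIn) {g : G → ℝ} (hg : Integrable g μ) :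
    Tendsto (fun k => ∫ x, |((φ k).normed μ ⋆[lsmul ℝ ℝ, μ] g) x - g x| ∂μ) atTop (𝓝 0) := by
  have key : ∀ u : G → ℝ, Integrable u μ → (∀ x, 0 ≤ u x) →
      Tendsto (fun k => ∫ x, |((φ k).normed μ ⋆[lsmul ℝ ℝ, μ] u) x - u x| ∂μ) atTop (𝓝 0) := by
    intro u hu hu0
    refine tendsto_integral_abs_sub_of_nonneg hu (fun k => (φ k).integrable_normed_convolution hu)
      hu0 (fun k x => integral_nonneg fun t => ?_)
      (ContDiffBump.ae_convolution_tendsto_right_of_locallyIntegrable hφ hK hu.locallyIntegrable)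
      (fun k => ?_)
    · exact mul_nonneg ((φ k).nonneg_normed _) (hu0 _)
    · rw [integral_convolution _ (φ k).integrable_normed hu, (φ k).integral_normed]
      simp
  have hp := key _ hg.pos_part fun x => le_max_right _ _
  have hn := key _ hg.neg_part fun x => le_max_right _ _
  refine squeeze_zero (fun k => integral_nonneg fun x => abs_nonneg _) (fun k => ?_)
    (by simpa using hp.add hn)
  have i1 := (φ k).integrable_normed_convolution hg.pos_part
  have i2 := (φ k).integrable_normed_convolution hg.neg_part
  refine (integral_mono (((φ k).integrable_normed_convolution hg).sub hg).abs
    ((i1.sub hg.pos_part).abs.add (i2.sub hg.neg_part).abs) fun x => ?_).trans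
    (integral_add (i1.sub hg.pos_part).abs (i2.sub hg.neg_part).abs).le
  have hex : ∀ {u : G → ℝ}, Integrable u μ →
      ConvolutionExists ((φ k).normed μ) u (lsmul ℝ ℝ) μ := fun hu =>
    (φ k).hasCompactSupport_normed.convolutionExists_left _ (φ k).continuous_normed
      hu.locallyIntegrable
  have e1 : (fun x => max (g x) 0) = g + fun x => max (-g x) 0 := by
    ext x
    simp only [Pi.add_apply]
    rcases le_total (g x) 0 with h | h
    · rw [max_eq_right h, max_eq_left (by linarith)]; ring
    · rw [max_eq_left h, max_eq_right (by linarith)]; ring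
  have e2 := congrFun ((hex hg).distrib_add (hex hg.neg_part)) x
  rw [← e1, Pi.add_apply] at e2
  have e3 := congrFun e1 x
  rw [Pi.add_apply] at e3
  simp only [Pi.sub_apply, Pi.add_apply]
  have : ((φ k).normed μ ⋆[lsmul ℝ ℝ, μ] g) x - g x
      = (((φ k).normed μ ⋆[lsmul ℝ ℝ, μ] fun x => max (g x) 0) x - max (g x) 0)
        - (((φ k).normed μ ⋆[lsmul ℝ ℝ, μ] fun x => max (-g x) 0) x - max (-g x) 0) := by
    rw [e2, e3]; ring
  rw [this]
  exact abs_sub _ _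

variable {n : ℕ} {Ω : Set (EuclideanSpace ℝ (Fin n))} {f : EuclideanSpace ℝ (Fin n) → ℝ}
  {g : EuclideanSpace ℝ (Fin n) → EuclideanSpace ℝ (Fin n)}

lemma SobolevW11.integrableOn_grad_apply (h : SobolevW11 Ω f g) (i : Fin n) :
    IntegrableOn (fun x => g x i) Ω :=
  (EuclideanSpace.proj i : EuclideanSpace ℝ (Fin n) →L[ℝ] ℝ).integrable_comp h.integrable_grad

/-- Away from the boundary, the mollification of a Sobolev function is differentiated by
mollifying the weak gradient. -/
lemma SobolevW11.fderiv_normed_convolution (hΩ : MeasurableSet Ω) (h : SobolevW11 Ω f g)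
    (φ : ContDiffBump (0 : EuclideanSpace ℝ (Fin n))) {x : EuclideanSpace ℝ (Fin n)}
    (hx : Metric.closedBall x φ.rOut ⊆ Ω) (i : Fin n) :
    fderiv ℝ (φ.normed volume ⋆[lsmul ℝ ℝ, volume] Ω.indicator f) x (EuclideanSpace.single i 1)
      = (φ.normed volume ⋆[lsmul ℝ ℝ, volume] Ω.indicator fun y => g y i) x := by
  set ρ := φ.normed volume with hρ
  have hρs : ContDiff ℝ ∞ ρ := φ.contDiff_normed (n := ⊤)
  have hρ1 : ContDiff ℝ 1 ρ := φ.contDiff_normed (n := 1)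
  have hρc : HasCompactSupport ρ := φ.hasCompactSupport_normed
  have hρd : Differentiable ℝ ρ := hρ1.differentiable one_ne_zero
  have hf0 : LocallyIntegrable (Ω.indicator f) :=
    (h.integrable_fun.integrable_indicator hΩ).locallyIntegrable
  have hz : ∀ y, y ∉ Metric.closedBall x φ.rOut → ρ (x - y) = 0 := by
    intro y hy
    have : x - y ∉ Function.support ρ := by
      rw [φ.support_normed_eq, mem_ball_zero_iff, not_lt, ← dist_eq_norm, dist_comm]
      exact (not_le.1 hy).le
    simpa using this
  have hts : tsupport (fun y => ρ (x - y)) ⊆ Metric.closedBall x φ.rOut :=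
    closure_minimal (fun y hy => by_contra fun hy' => hy (hz y hy')) Metric.isClosed_closedBall
  -- The weak gradient is tested against the reflected, translated kernel; the ball hypothesis makes
  -- it admissible.
  have hw := h.weak_grad (fun y => ρ (x - y)) (hρs.comp (contDiff_const.sub contDiff_id))
    (HasCompactSupport.intro (isCompact_closedBall x φ.rOut) hz) (hts.trans hx) i
  have hd : ∀ y, fderiv ℝ (fun y => ρ (x - y)) y (EuclideanSpace.single i 1)
      = -fderiv ℝ ρ (x - y) (EuclideanSpace.single i 1) := by
    intro y
    have h1 : HasFDerivAt (fun y => ρ (x - y)) ((fderiv ℝ ρ (x - y)).comp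
        (-ContinuousLinearMap.id ℝ (EuclideanSpace ℝ (Fin n)))) y :=
      (hρd (x - y)).hasFDerivAt.comp y ((hasFDerivAt_id y).const_sub x)
    rw [h1.fderiv]
    simp
  simp_rw [hd, mul_neg] at hw
  rw [integral_neg, neg_inj] at hw
  rw [← convolution_flip, (hρc.hasFDerivAt_convolution_right _ hf0 hρ1 x).fderiv,
    convolution_precompR_apply _ hf0 (hρc.fderiv ℝ) (hρ1.continuous_fderiv one_ne_zero),
    ← convolution_flip, convolution_def, convolution_def]
  simp only [flip_apply, lsmul_apply, smul_eq_mul]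
  have e : ∀ (u w : EuclideanSpace ℝ (Fin n) → ℝ),
      ∫ t, w t * Ω.indicator u (x - t) = ∫ y in Ω, u y * w (x - y) := by
    intro u w
    rw [← integral_sub_left_eq_self _ volume x, ← integral_indicator hΩ]
    congr with y
    by_cases hy : y ∈ Ω <;> simp [hy, mul_comm]
  rw [e f fun t => fderiv ℝ ρ t (EuclideanSpace.single i 1), e _ ρ]
  exact hw

end Mollification

/-! ### Chain rule and truncation in the Sobolev space. -/

section ChainRule

open Filter Topology ContinuousLinearMap
open scoped Convolution

variable {n : ℕ} {Ω : Set (EuclideanSpace ℝ (Fin n))} {f : EuclideanSpace ℝ (Fin n) → ℝ}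
  {g : EuclideanSpace ℝ (Fin n) → EuclideanSpace ℝ (Fin n)}

lemma abs_sub_le_of_hasDerivAt {η ψ : ℝ → ℝ} (hη : ∀ t, HasDerivAt η (ψ t) t)
    (hψ1 : ∀ t, |ψ t| ≤ 1) (x y : ℝ) : |η x - η y| ≤ |x - y| := by
  simpa using convex_univ.norm_image_sub_le_of_norm_hasDerivWithin_le
    (fun t _ => (hη t).hasDerivWithinAt) (fun t _ => hψ1 t) (mem_univ y) (mem_univ x)

/-- Chain rule for the composition of a Sobolev function with a `C^1` function with bounded
derivative. -/
lemma SobolevW11.integral_comp_mul_fderiv (hΩ : IsOpen Ω) (h : SobolevW11 Ω f g) {η ψ : ℝ → ℝ}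
    (hη : ∀ t, HasDerivAt η (ψ t) t) (hψ : Continuous ψ) (hψ1 : ∀ t, |ψ t| ≤ 1)
    {φ : EuclideanSpace ℝ (Fin n) → ℝ} (hφ : ContDiff ℝ ∞ φ) (hφc : HasCompactSupport φ)
    (hφΩ : tsupport φ ⊆ Ω) (i : Fin n) :
    ∫ x in Ω, η (f x) * fderiv ℝ φ x (EuclideanSpace.single i 1)
      = -∫ x in Ω, ψ (f x) * g x i * φ x := by
  obtain ⟨δ, hδ, hδΩ⟩ := hφc.isCompact.exists_cthickening_subset_open hΩ hφΩ
  have hr : ∀ k : ℕ, 0 < δ / (2 * ((k : ℝ) + 1)) := fun k => by positivity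
  -- The outer radius is δ/(k+1) ≤ δ, so balls centred on the support of φ stay in Ω; it is twice
  -- the inner radius, as a bounded ratio is needed for a.e. convergence.
  set b : ℕ → ContDiffBump (0 : EuclideanSpace ℝ (Fin n)) := fun k =>
    ⟨δ / (2 * ((k : ℝ) + 1)), 2 * (δ / (2 * ((k : ℝ) + 1))), hr k, by linarith [hr k]⟩ with hb
  have hbout : ∀ k, (b k).rOut = δ * (1 / ((k : ℝ) + 1)) := fun k => by
    simp only [hb]; field_simp
  have hb0 : Tendsto (fun k => (b k).rOut) atTop (𝓝 0) := by
    simp_rw [hbout]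
    simpa using tendsto_one_div_add_atTop_nhds_zero_nat.const_mul δ
  have hbK : ∀ᶠ k in atTop, (b k).rOut ≤ 2 * (b k).rIn := Eventually.of_forall fun k => le_rfl
  have hbΩ : ∀ k, ∀ x ∈ tsupport φ, Metric.closedBall x (b k).rOut ⊆ Ω := by
    intro k x hx
    refine (Metric.closedBall_subset_closedBall ?_).trans
      ((Metric.closedBall_subset_cthickening hx δ).trans hδΩ)
    rw [hbout]
    refine mul_le_of_le_one_right hδ.le ?_
    rw [div_le_one (by positivity)]
    linarith [(Nat.cast_nonneg k : (0 : ℝ) ≤ k)]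
  set e : EuclideanSpace ℝ (Fin n) := EuclideanSpace.single i 1
  set f0 := Ω.indicator f with hf0
  set g0 := Ω.indicator fun y => g y i with hg0
  have hf0i : Integrable f0 := h.integrable_fun.integrable_indicator hΩ.measurableSet
  have hg0i : Integrable g0 := (h.integrableOn_grad_apply i).integrable_indicator hΩ.measurableSet
  set F : ℕ → EuclideanSpace ℝ (Fin n) → ℝ :=
    fun k => (b k).normed volume ⋆[lsmul ℝ ℝ, volume] f0 with hF
  set H : ℕ → EuclideanSpace ℝ (Fin n) → ℝ :=
    fun k => (b k).normed volume ⋆[lsmul ℝ ℝ, volume] g0 with hH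
  have hFi : ∀ k, Integrable (F k) := fun k => (b k).integrable_normed_convolution hf0i
  have hHi : ∀ k, Integrable (H k) := fun k => (b k).integrable_normed_convolution hg0i
  have hFs : ∀ k, ContDiff ℝ 1 (F k) := fun k =>
    (b k).hasCompactSupport_normed.contDiff_convolution_left (n := 1) _
      ((b k).contDiff_normed (n := 1)) hf0i.locallyIntegrable
  have hφ1 : ContDiff ℝ 1 φ := hφ.of_le (by exact_mod_cast le_top)
  have hφd : Continuous fun x => fderiv ℝ φ x e :=
    (hφ1.continuous_fderiv one_ne_zero).clm_apply continuous_const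
  have hφdc : HasCompactSupport fun x => fderiv ℝ φ x e :=
    (hφc.fderiv ℝ).comp_left (g := fun L : EuclideanSpace ℝ (Fin n) →L[ℝ] ℝ => L e) (by simp)
  obtain ⟨B, hB⟩ := hφc.exists_bound_of_continuous hφ.continuous
  obtain ⟨B', hB'⟩ := hφdc.exists_bound_of_continuous hφd
  have hηc : Continuous η := continuous_iff_continuousAt.2 fun t => (hη t).continuousAt
  have hη1 : ContDiff ℝ 1 η := by
    rw [contDiff_one_iff_deriv]
    refine ⟨fun t => (hη t).differentiableAt, ?_⟩
    rwa [show deriv η = ψ from funext fun t => (hη t).deriv]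
  have hηF : ∀ k, ContDiff ℝ 1 fun x => η (F k x) := fun k => hη1.comp (hFs k)
  have hdF : ∀ k x, fderiv ℝ (fun x => η (F k x)) x e = ψ (F k x) * fderiv ℝ (F k) x e := by
    intro k x
    have := (hη (F k x)).comp_hasFDerivAt x
      (((hFs k).differentiable one_ne_zero) x).hasFDerivAt
    rw [HasFDerivAt.fderiv (f := fun x => η (F k x)) this]
    simp
  -- integration by parts for the mollified functions
  have ibp : ∀ k, ∫ x, η (F k x) * fderiv ℝ φ x e = -∫ x, ψ (F k x) * φ x * H k x := by
    intro k
    rw [integral_mul_fderiv_eq_neg_fderiv_mul_of_integrable]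
    · congr 2 with x
      by_cases hx : x ∈ tsupport φ
      · rw [hdF, h.fderiv_normed_convolution hΩ.measurableSet (b k) (hbΩ k x hx) i]
        ring
      · simp [image_eq_zero_of_notMem_tsupport hx]
    · exact ((((hηF k).continuous_fderiv one_ne_zero).clm_apply continuous_const).mul
        hφ.continuous).integrable_of_hasCompactSupport hφc.mul_left
    · exact ((hηF k).continuous.mul hφd).integrable_of_hasCompactSupport hφdc.mul_left
    · exact ((hηF k).continuous.mul hφ.continuous).integrable_of_hasCompactSupport hφc.mul_left
    · exact fun x _ => (hηF k).differentiable one_ne_zero x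
    · exact fun x _ => hφ1.differentiable one_ne_zero x
  have hB0 : 0 ≤ B := (norm_nonneg _).trans (hB 0)
  have hB0' : 0 ≤ B' := (norm_nonneg _).trans (hB' 0)
  have lim1 : Tendsto (fun k => ∫ x, η (F k x) * fderiv ℝ φ x e) atTop
      (𝓝 (∫ x, η (f0 x) * fderiv ℝ φ x e)) := by
    have hmain := ContDiffBump.tendsto_integral_abs_normed_convolution_sub hb0 hbK hf0i
    have hi : ∀ k, Integrable fun x => (η (F k x) - η (f0 x)) * fderiv ℝ φ x e := fun k => by
      refine (((hFi k).sub hf0i).norm.mul_const B').mono' ?_ (ae_of_all _ fun x => ?_)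
      · exact (((hηF k).continuous.aestronglyMeasurable).sub
          (hηc.comp_aestronglyMeasurable hf0i.aestronglyMeasurable)).mul hφd.aestronglyMeasurable
      · rw [norm_mul]
        gcongr
        · exact abs_sub_le_of_hasDerivAt hη hψ1 _ _
        · exact hB' x
    have hi1 : ∀ k, Integrable fun x => η (F k x) * fderiv ℝ φ x e := fun k =>
      ((hηF k).continuous.mul hφd).integrable_of_hasCompactSupport hφdc.mul_left
    have hi2 : Integrable fun x => η (f0 x) * fderiv ℝ φ x e := by
      refine ((hi1 0).sub (hi 0)).congr (ae_of_all _ fun x => ?_)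
      simp only [Pi.sub_apply]; ring
    rw [tendsto_iff_norm_sub_tendsto_zero]
    refine squeeze_zero (fun _ => norm_nonneg _) (fun k => ?_)
      (by simpa using hmain.mul_const B')
    rw [← integral_sub (hi1 k) hi2, ← integral_mul_const]
    refine (norm_integral_le_integral_norm _).trans (integral_mono ((hi1 k).sub hi2).norm
      (((hFi k).sub hf0i).abs.mul_const B') fun x => ?_)
    simp only [← sub_mul, norm_mul]
    refine mul_le_mul ?_ (hB' x) (norm_nonneg _) (abs_nonneg _)
    exact abs_sub_le_of_hasDerivAt hη hψ1 _ _
  have hψF : ∀ k, AEStronglyMeasurable (fun x => ψ (F k x) * φ x) volume := fun k =>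
    ((hψ.comp (hFs k).continuous).mul hφ.continuous).aestronglyMeasurable
  have hψb : ∀ t x, ‖ψ t * φ x‖ ≤ B := fun t x => by
    rw [norm_mul]
    calc ‖ψ t‖ * ‖φ x‖ ≤ 1 * B := mul_le_mul (hψ1 t) (hB x) (norm_nonneg _) zero_le_one
      _ = B := one_mul B
  -- Two errors are separated: replacing H k by g0 costs at most B times an L¹ distance, and
  -- replacing F k by f0 inside ψ is dominated convergence, from a.e. convergence of F k.
  have lim2 : Tendsto (fun k => ∫ x, ψ (F k x) * φ x * H k x) atTop
      (𝓝 (∫ x, ψ (f0 x) * φ x * g0 x)) := by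
    have hmain := ContDiffBump.tendsto_integral_abs_normed_convolution_sub hb0 hbK hg0i
    have hig : ∀ k, Integrable fun x => ψ (F k x) * φ x * g0 x := fun k =>
      hg0i.bdd_mul (hψF k) (ae_of_all _ fun x => hψb _ x)
    have hiH : ∀ k, Integrable fun x => ψ (F k x) * φ x * H k x := fun k =>
      (hHi k).bdd_mul (hψF k) (ae_of_all _ fun x => hψb _ x)
    have l1 : Tendsto (fun k => ∫ x, ψ (F k x) * φ x * g0 x) atTop
        (𝓝 (∫ x, ψ (f0 x) * φ x * g0 x)) := by
      refine tendsto_integral_of_dominated_convergence (fun x => B * ‖g0 x‖)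
        (fun k => (hig k).aestronglyMeasurable) (hg0i.norm.const_mul B)
        (fun k => ae_of_all _ fun x => ?_) ?_
      · rw [norm_mul]
        gcongr
        exact hψb _ x
      · filter_upwards [ContDiffBump.ae_convolution_tendsto_right_of_locallyIntegrable hb0 hbK
          hf0i.locallyIntegrable] with x hx
        exact (((hψ.tendsto _).comp hx).mul_const _).mul_const _
    have l2 : Tendsto (fun k => ∫ x, ψ (F k x) * φ x * H k x - ψ (F k x) * φ x * g0 x) atTop
        (𝓝 0) := by
      refine squeeze_zero_norm (fun k => ?_) (by simpa using hmain.const_mul B)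
      rw [← integral_const_mul]
      refine (norm_integral_le_integral_norm _).trans (integral_mono ((hiH k).sub (hig k)).norm
        (((hHi k).sub hg0i).abs.const_mul B) fun x => ?_)
      simp only [← mul_sub, norm_mul _ (_ - _)]
      exact mul_le_mul_of_nonneg_right (hψb _ x) (norm_nonneg _)
    refine Tendsto.congr (fun k => ?_) (by simpa using l2.add l1)
    rw [integral_sub (hiH k) (hig k), sub_add_cancel]
  have hfin := tendsto_nhds_unique lim1 (lim2.neg.congr fun k => (ibp k).symm)
  have hz : ∀ x, x ∉ Ω → φ x = 0 := fun x hx =>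
    image_eq_zero_of_notMem_tsupport fun hx' => hx (hφΩ hx')
  have hzd : ∀ x, x ∉ Ω → fderiv ℝ φ x e = 0 := fun x hx => by
    rw [image_eq_zero_of_notMem_tsupport fun hx' => hx (hφΩ (tsupport_fderiv_subset ℝ hx'))]
    rfl
  calc _ = ∫ x in Ω, η (f0 x) * fderiv ℝ φ x e :=
        setIntegral_congr_fun hΩ.measurableSet fun x hx => by simp [hf0, hx]
    _ = ∫ x, η (f0 x) * fderiv ℝ φ x e :=
        setIntegral_eq_integral_of_forall_compl_eq_zero fun x hx => by rw [hzd x hx, mul_zero]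
    _ = -∫ x, ψ (f0 x) * φ x * g0 x := hfin
    _ = -∫ x in Ω, ψ (f0 x) * φ x * g0 x := by
        rw [setIntegral_eq_integral_of_forall_compl_eq_zero fun x hx => by
          rw [hz x hx, mul_zero, zero_mul]]
    _ = _ := by
        congr 1
        refine setIntegral_congr_fun hΩ.measurableSet fun x hx => ?_
        simp only [hf0, hg0, indicator_of_mem hx]
        ring

/-- The piecewise linear continuous approximation of the indicator function of `(a, b]`. -/
noncomputable def rampIndicator (a b : ℝ) (k : ℕ) (t : ℝ) : ℝ :=
  max 0 (min 1 (k * (t - a))) - max 0 (min 1 (k * (t - b)))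

lemma continuous_rampIndicator (a b : ℝ) (k : ℕ) : Continuous (rampIndicator a b k) := by
  unfold rampIndicator; fun_prop

lemma abs_rampIndicator_le (a b : ℝ) (k : ℕ) (t : ℝ) : |rampIndicator a b k t| ≤ 1 := by
  have h : ∀ y : ℝ, 0 ≤ max 0 (min 1 y) ∧ max 0 (min 1 y) ≤ 1 := fun y =>
    ⟨le_max_left _ _, max_le zero_le_one (min_le_left _ _)⟩
  have h1 := h (k * (t - a))
  have h2 := h (k * (t - b))
  rw [rampIndicator, abs_le]
  constructor <;> linarith [h1.1, h1.2, h2.1, h2.2]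

lemma tendsto_ramp (a t : ℝ) :
    Tendsto (fun k : ℕ => max 0 (min 1 ((k : ℝ) * (t - a)))) atTop (𝓝 (if a < t then 1 else 0)) := by
  split_ifs with h
  · have h1 : Tendsto (fun k : ℕ => (k : ℝ) * (t - a)) atTop atTop :=
      tendsto_natCast_atTop_atTop.atTop_mul_const (sub_pos.2 h)
    refine tendsto_const_nhds.congr' ?_
    filter_upwards [h1.eventually_ge_atTop 1] with k hk
    rw [min_eq_left hk, max_eq_right zero_le_one]
  · refine tendsto_const_nhds.congr fun k => ?_
    have : (k : ℝ) * (t - a) ≤ 0 :=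
      mul_nonpos_of_nonneg_of_nonpos k.cast_nonneg (by linarith)
    rw [min_eq_right (this.trans zero_le_one), max_eq_left this]

lemma tendsto_rampIndicator {a b : ℝ} (hab : a ≤ b) (t : ℝ) :
    Tendsto (fun k => rampIndicator a b k t) atTop (𝓝 ((Ioc a b).indicator 1 t)) := by
  have e : (Ioc a b).indicator (1 : ℝ → ℝ) t
      = (if a < t then 1 else 0) - (if b < t then 1 else 0) := by
    by_cases h1 : a < t <;> by_cases h2 : b < t
    · simp [h1, h2]
    · simp [h1, h2, not_lt.1 h2]
    · exact absurd (hab.trans_lt h2) h1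
    · simp [h1, h2]
  rw [e]
  exact (tendsto_ramp a t).sub (tendsto_ramp b t)

lemma intervalIntegral_indicator_Ioc {a b : ℝ} (hab : a ≤ b) (x : ℝ) :
    ∫ t in a..x, (Ioc a b).indicator (1 : ℝ → ℝ) t = max a (min b x) - a := by
  rcases le_total a x with h | h
  · rw [intervalIntegral.integral_of_le h, integral_indicator_one measurableSet_Ioc,
      measureReal_restrict_apply measurableSet_Ioc, Ioc_inter_Ioc, sup_idem,
      max_eq_right (le_min hab h), measureReal_def, Real.volume_Ioc,
      ENNReal.toReal_ofReal (sub_nonneg.2 (le_min hab h))]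
  · rw [intervalIntegral.integral_of_ge h, min_eq_right (h.trans hab), max_eq_left h, sub_self,
      integral_indicator_one measurableSet_Ioc, measureReal_restrict_apply measurableSet_Ioc,
      Ioc_inter_Ioc, max_eq_left h, Ioc_eq_empty_of_le (min_le_right _ _)]
    simp

lemma tendsto_integral_rampIndicator {a b : ℝ} (hab : a ≤ b) (x : ℝ) :
    Tendsto (fun k => a + ∫ t in a..x, rampIndicator a b k t) atTop (𝓝 (max a (min b x))) := by
  have h := intervalIntegral.tendsto_integral_filter_of_dominated_convergence
    (μ := volume) (a := a) (b := x) (l := atTop) (F := fun k => rampIndicator a b k)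
    (f := (Ioc a b).indicator 1) (fun _ => (1 : ℝ))
    (Eventually.of_forall fun k => (continuous_rampIndicator a b k).aestronglyMeasurable)
    (Eventually.of_forall fun k => ae_of_all _ fun t _ => abs_rampIndicator_le a b k t)
    (by simp) (ae_of_all _ fun t _ => tendsto_rampIndicator hab t)
  rw [intervalIntegral_indicator_Ioc hab] at h
  simpa using h.const_add a

/-- The truncation of a Sobolev function between two levels is a Sobolev function. -/
lemma SobolevW11.clamp (hΩ : IsOpen Ω) (hΩv : volume Ω ≠ ⊤) (h : SobolevW11 Ω f g) {a b : ℝ}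
    (hab : a ≤ b) :
    SobolevW11 Ω (fun x => max a (min b (f x))) ({x | a < f x ∧ f x ≤ b}.indicator g) := by
  have : IsFiniteMeasure (volume.restrict Ω) := ⟨by simpa using hΩv.lt_top⟩
  have hfm := h.integrable_fun.aestronglyMeasurable.aemeasurable
  have hs : NullMeasurableSet {x | a < f x ∧ f x ≤ b} (volume.restrict Ω) :=
    (nullMeasurableSet_lt aemeasurable_const hfm).inter
      (nullMeasurableSet_le hfm aemeasurable_const)
  have hcont : Continuous fun t : ℝ => max a (min b t) := by fun_prop
  refine ⟨?_, Integrable.indicator₀ h.integrable_grad hs, fun φ hφ hφc hφΩ i => ?_⟩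
  · refine Integrable.mono' (integrable_const (max |a| |b|))
      (hcont.comp_aestronglyMeasurable h.integrable_fun.aestronglyMeasurable)
      (ae_of_all _ fun x => ?_)
    exact abs_le_max_abs_abs (le_max_left _ _) (max_le hab (min_le_left _ _))
  -- The clamp is not C¹, so the chain rule is applied to primitives of the continuous ramps; as k
  -- grows these converge to the clamp and their derivatives to the indicator of (a, b].
  have hη : ∀ k t, HasDerivAt (fun y => a + ∫ t in a..y, rampIndicator a b k t)
      (rampIndicator a b k t) t := fun k t =>
    ((continuous_rampIndicator a b k).integral_hasStrictDerivAt a t).hasDerivAt.const_add a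
  have hmain := fun k => h.integral_comp_mul_fderiv hΩ (hη k) (continuous_rampIndicator a b k)
    (abs_rampIndicator_le a b k) hφ hφc hφΩ i
  set e : EuclideanSpace ℝ (Fin n) := EuclideanSpace.single i 1
  have hφ1 : ContDiff ℝ 1 φ := hφ.of_le (by exact_mod_cast le_top)
  have hφd : Continuous fun x => fderiv ℝ φ x e :=
    (hφ1.continuous_fderiv one_ne_zero).clm_apply continuous_const
  have hφdc : HasCompactSupport fun x => fderiv ℝ φ x e :=
    (hφc.fderiv ℝ).comp_left (g := fun L : EuclideanSpace ℝ (Fin n) →L[ℝ] ℝ => L e) (by simp)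
  obtain ⟨B, hB⟩ := hφc.exists_bound_of_continuous hφ.continuous
  obtain ⟨B', hB'⟩ := hφdc.exists_bound_of_continuous hφd
  have hgi := h.integrableOn_grad_apply i
  have hηc : ∀ k, Continuous fun y => a + ∫ t in a..y, rampIndicator a b k t := fun k =>
    continuous_iff_continuousAt.2 fun t => (hη k t).continuousAt
  have lim1 : Tendsto
      (fun k => ∫ x in Ω, (a + ∫ t in a..f x, rampIndicator a b k t) * fderiv ℝ φ x e) atTop
      (𝓝 (∫ x in Ω, max a (min b (f x)) * fderiv ℝ φ x e)) := by
    refine tendsto_integral_of_dominated_convergence (fun x => (|a| + |f x - a|) * B')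
      (fun k => ((hηc k).comp_aestronglyMeasurable
        h.integrable_fun.aestronglyMeasurable).mul hφd.aestronglyMeasurable)
      (((integrable_const |a|).add (h.integrable_fun.sub (integrable_const a)).abs).mul_const B')
      (fun k => ae_of_all _ fun x => ?_)
      (ae_of_all _ fun x => (tendsto_integral_rampIndicator hab (f x)).mul_const _)
    rw [norm_mul]
    refine mul_le_mul ((norm_add_le _ _).trans (add_le_add le_rfl ?_)) (hB' x) (norm_nonneg _)
      (by positivity)
    simpa using intervalIntegral.norm_integral_le_of_norm_le_const (a := a) (b := f x)
      (f := rampIndicator a b k) (C := 1) fun t _ => abs_rampIndicator_le a b k t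
  have lim2 : Tendsto (fun k => ∫ x in Ω, rampIndicator a b k (f x) * g x i * φ x) atTop
      (𝓝 (∫ x in Ω, (Ioc a b).indicator 1 (f x) * g x i * φ x)) := by
    refine tendsto_integral_of_dominated_convergence (fun x => |g x i| * B)
      (fun k => (((continuous_rampIndicator a b k).comp_aestronglyMeasurable
        h.integrable_fun.aestronglyMeasurable).mul hgi.aestronglyMeasurable).mul
        hφ.continuous.aestronglyMeasurable)
      (hgi.abs.mul_const B) (fun k => ae_of_all _ fun x => ?_)
      (ae_of_all _ fun x => ((tendsto_rampIndicator hab (f x)).mul_const _).mul_const _)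
    rw [norm_mul, norm_mul]
    refine mul_le_mul ?_ (hB x) (norm_nonneg _) (abs_nonneg _)
    exact mul_le_of_le_one_left (abs_nonneg _) (abs_rampIndicator_le a b k _)
  rw [tendsto_nhds_unique lim1 (lim2.neg.congr fun k => (hmain k).symm)]
  congr 1
  refine integral_congr_ae (ae_of_all _ fun x => ?_)
  by_cases hx : a < f x ∧ f x ≤ b
  · simp [indicator_of_mem (show x ∈ {x | a < f x ∧ f x ≤ b} from hx),
      indicator_of_mem (show f x ∈ Ioc a b from hx)]
  · simp [indicator_of_notMem (show x ∉ {x | a < f x ∧ f x ≤ b} from hx),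
      indicator_of_notMem (show f x ∉ Ioc a b from hx)]

lemma SobolevW11.neg (h : SobolevW11 Ω f g) : SobolevW11 Ω (-f) (-g) where
  integrable_fun := h.integrable_fun.neg
  integrable_grad := h.integrable_grad.neg
  weak_grad φ hφ hφc hφΩ i := by
    simp [integral_neg, h.weak_grad φ hφ hφc hφΩ i]

end ChainRule

/-! ### Existence of medians. -/

section Median

variable {α : Type*} [MeasurableSpace α] {μ : Measure α} [IsProbabilityMeasure μ] {f : α → ℝ}

lemma measure_le_add_measure_lt (hf : AEMeasurable f μ) (x : ℝ) :
    μ {y | f y ≤ x} + μ {y | x < f y} = 1 := by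
  have h := measure_add_measure_compl₀ (nullMeasurableSet_le hf aemeasurable_const :
    NullMeasurableSet {y | f y ≤ x} μ)
  rw [measure_univ] at h
  rw [← h]
  congr 2
  ext y
  simp

lemma half_le_iff_of_add_eq_one {a b : ℝ≥0∞} (h : a + b = 1) : 1 / 2 ≤ a ↔ b ≤ 1 / 2 := by
  have ha : a ≠ ⊤ := fun h' => by simp [h'] at h
  have hb : b ≠ ⊤ := fun h' => by simp [h'] at h
  lift a to ℝ≥0 using ha
  lift b to ℝ≥0 using hb
  have h2 : ((1 / 2 : ℝ≥0) : ℝ≥0∞) = 1 / 2 := by simp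
  rw [← h2]
  norm_cast at h ⊢
  have h3 : (a : ℝ) + b = 1 := by exact_mod_cast h
  rw [← NNReal.coe_le_coe, ← NNReal.coe_le_coe]
  push_cast
  constructor <;> intro <;> linarith

/-- The witness is the least x with μ{f > x} ≤ 1/2. One inequality is right-continuity of the
distribution function; the other is the same fact for -f, using that smaller x fail. -/
lemma exists_isMedian (hf : AEMeasurable f μ) : ∃ r, IsMedian μ f r := by
  set S : Set ℝ := {x | μ {y | x < f y} ≤ 1 / 2} with hS
  have hne : S.Nonempty := by
    obtain ⟨l, -, hl⟩ := exists_measure_lt_le hf (c := 1 / 2) (by simp)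
    exact ⟨l, hl⟩
  have hbdd : BddBelow S := by
    obtain ⟨l, -, hl⟩ := exists_measure_lt_le hf.neg (c := 1 / 4) (by simp)
    refine ⟨-l - 1, fun x hx => ?_⟩
    by_contra! hlt
    have h1 := (half_le_iff_of_add_eq_one (measure_le_add_measure_lt hf x)).2 hx
    have h2 : μ {y | f y ≤ x} ≤ 1 / 4 := by
      refine le_trans (measure_mono fun y hy => ?_) hl
      simp only [mem_ofPred_eq, Pi.neg_apply] at hy ⊢
      linarith
    have h3 := h1.trans h2
    rw [one_div, one_div, ENNReal.inv_le_inv] at h3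
    norm_num at h3
  refine ⟨sInf S, ?_, ?_⟩
  · have h1 : μ {y | -sInf S < -f y} ≤ 1 / 2 := by
      refine measure_lt_le_of_forall_gt fun l' hl' => ?_
      have h2 : -l' ∉ S := fun h => by linarith [csInf_le hbdd h]
      have h3 := (half_le_iff_of_add_eq_one (measure_le_add_measure_lt hf (-l'))).not.2 h2
      refine le_trans (measure_mono fun y hy => ?_) (not_le.1 h3).le
      simp only [mem_ofPred_eq] at hy ⊢
      linarith
    have h4 := measure_le_add_measure_lt hf.neg (-sInf S)
    have h5 := (half_le_iff_of_add_eq_one h4).2 h1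
    simpa using h5
  · rw [half_le_iff_of_add_eq_one (measure_le_add_measure_lt hf _)]
    refine measure_lt_le_of_forall_gt fun l' hl' => ?_
    obtain ⟨x, hx, hxl⟩ := exists_lt_of_csInf_lt hne hl'
    exact le_trans (measure_mono fun y hy => lt_trans hxl hy) hx

end Median

/-! ### From the Sobolev–Poincaré inequality to the truncation bound. -/

section Truncation

variable {α : Type*} [MeasurableSpace α] {μ : Measure α}

lemma mul_measure_rpow_le_lintegral_rpow {u : α → ℝ} (hu : AEMeasurable u μ) {p : ℝ} (hp : 0 < p)
    {A : Set α} {c : ℝ} (hc : ∀ x ∈ A, c ≤ |u x|) :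
    ENNReal.ofReal c * μ A ^ (1 / p) ≤ (∫⁻ x, ‖u x‖ₑ ^ p ∂μ) ^ (1 / p) := by
  have h1 := mul_meas_ge_le_lintegral₀ (hu.enorm.pow_const p) (ENNReal.ofReal c ^ p)
  have h2 : ENNReal.ofReal c ^ p * μ A ≤ ∫⁻ x, ‖u x‖ₑ ^ p ∂μ := by
    refine le_trans ?_ h1
    gcongr
    intro x hx
    have : ENNReal.ofReal c ≤ ‖u x‖ₑ := by
      rw [← ofReal_norm]
      exact ENNReal.ofReal_le_ofReal (hc x hx)
    exact ENNReal.rpow_le_rpow this hp.le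
  calc ENNReal.ofReal c * μ A ^ (1 / p)
      = (ENNReal.ofReal c ^ p * μ A) ^ (1 / p) := by
        rw [ENNReal.mul_rpow_of_nonneg _ _ (by positivity), ← ENNReal.rpow_mul,
          mul_one_div_cancel hp.ne', ENNReal.rpow_one]
    _ ≤ _ := by gcongr

variable {n : ℕ} {Ω : Set (EuclideanSpace ℝ (Fin n))} {f : EuclideanSpace ℝ (Fin n) → ℝ}
  {g : EuclideanSpace ℝ (Fin n) → EuclideanSpace ℝ (Fin n)}

/-- The Sobolev–Poincaré inequality applied to a truncation that vanishes on half of `Ω`. -/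
lemma SobolevW11.mul_measure_lt_rpow_le (hΩ : IsOpen Ω) (hΩv : volume Ω = 1) {p : ℝ} (hp : 0 < p)
    {K : ℝ≥0} (hK : ∀ (f : EuclideanSpace ℝ (Fin n) → ℝ)
      (g : EuclideanSpace ℝ (Fin n) → EuclideanSpace ℝ (Fin n)), SobolevW11 Ω f g →
      (∫⁻ x in Ω, ‖f x - ⨍ y in Ω, f y‖ₑ ^ p) ^ (1 / p) ≤ K * ∫⁻ x in Ω, ‖g x‖ₑ)
    (h : SobolevW11 Ω f g) {a b : ℝ} (hab : a < b)
    (hm : 1 / 2 ≤ volume.restrict Ω {x | f x ≤ a}) :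
    ENNReal.ofReal (b - a) * volume.restrict Ω {x | b < f x} ^ (1 / p)
      ≤ 2 * K * ∫⁻ x in {x | a < f x ∧ f x ≤ b}, ‖g x‖ₑ ∂(volume.restrict Ω) := by
  have hprob : IsProbabilityMeasure (volume.restrict Ω) := ⟨by simpa using hΩv⟩
  set μ := volume.restrict Ω with hμ
  have hfm : AEMeasurable f μ := h.integrable_fun.aestronglyMeasurable.aemeasurable
  have hT := h.clamp hΩ (by simp [hΩv]) hab.le
  have hP := hK _ _ hT
  have hTm := hT.integrable_fun.aestronglyMeasurable.aemeasurable
  set m := ⨍ y in Ω, max a (min b (f y)) with hmdef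
  have hs : NullMeasurableSet {x | a < f x ∧ f x ≤ b} μ :=
    (nullMeasurableSet_lt aemeasurable_const hfm).inter
      (nullMeasurableSet_le hfm aemeasurable_const)
  simp_rw [enorm_indicator_eq_indicator_enorm] at hP
  rw [lintegral_indicator₀ hs] at hP
  set J := (K : ℝ≥0∞) * ∫⁻ x in {x | a < f x ∧ f x ≤ b}, ‖g x‖ₑ ∂μ with hJ
  -- The clamp equals a on {f ≤ a} and b on {f > b}. Chebyshev bounds its distance from the mean m
  -- on each set, and b - a ≤ |a - m| + |b - m|; the first set is the larger one, so no estimate of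
  -- m is needed.
  have h1 : ENNReal.ofReal |a - m| * μ {x | f x ≤ a} ^ (1 / p) ≤ J := by
    refine (mul_measure_rpow_le_lintegral_rpow (hTm.sub_const m) hp fun x hx => ?_).trans hP
    rw [max_eq_left ((min_le_right _ _).trans hx)]
  have h2 : ENNReal.ofReal |b - m| * μ {x | b < f x} ^ (1 / p) ≤ J := by
    refine (mul_measure_rpow_le_lintegral_rpow (hTm.sub_const m) hp fun x hx => ?_).trans hP
    rw [min_eq_left (le_of_lt hx), max_eq_right hab.le]
  have h3 : μ {x | b < f x} ≤ μ {x | f x ≤ a} := by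
    refine le_trans ?_ hm
    refine (measure_mono fun x hx => ?_).trans
      ((half_le_iff_of_add_eq_one (measure_le_add_measure_lt hfm a)).1 hm)
    exact hab.trans hx
  calc ENNReal.ofReal (b - a) * μ {x | b < f x} ^ (1 / p)
      ≤ (ENNReal.ofReal |a - m| + ENNReal.ofReal |b - m|) * μ {x | b < f x} ^ (1 / p) := by
        gcongr
        rw [← ENNReal.ofReal_add (abs_nonneg _) (abs_nonneg _)]
        refine ENNReal.ofReal_le_ofReal ?_
        linarith [neg_abs_le (a - m), le_abs_self (b - m)]
    _ ≤ ENNReal.ofReal |a - m| * μ {x | f x ≤ a} ^ (1 / p)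
          + ENNReal.ofReal |b - m| * μ {x | b < f x} ^ (1 / p) := by
        rw [add_mul]; gcongr
    _ ≤ J + J := add_le_add h1 h2
    _ = _ := by rw [hJ]; ring

/-- The one-sided estimate is applied to f above r and to -f above -r, both allowed by the median
property. The two layers are disjoint, so their gradient integrals add, while 1/p ≤ 1 makes the
power subadditive on the left. -/
lemma SobolevW11.weakTruncationBound (hΩ : IsOpen Ω) (hΩv : volume Ω = 1) {p : ℝ} (hp : 1 ≤ p)
    {K : ℝ≥0} (hK : ∀ (f : EuclideanSpace ℝ (Fin n) → ℝ)
      (g : EuclideanSpace ℝ (Fin n) → EuclideanSpace ℝ (Fin n)), SobolevW11 Ω f g →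
      (∫⁻ x in Ω, ‖f x - ⨍ y in Ω, f y‖ₑ ^ p) ^ (1 / p) ≤ K * ∫⁻ x in Ω, ‖g x‖ₑ)
    (h : SobolevW11 Ω f g) {r : ℝ} (hr : IsMedian (volume.restrict Ω) f r) :
    WeakTruncationBound (volume.restrict Ω)
      ((2 * K) • (volume.restrict Ω).withDensity fun x => ‖g x‖ₑ) (fun x => f x - r) p := by
  intro a b ha hab
  have hprob : IsProbabilityMeasure (volume.restrict Ω) := ⟨by simpa using hΩv⟩
  set μ := volume.restrict Ω with hμ
  have hp0 : 0 < p := by linarith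
  have hfm : AEMeasurable f μ := h.integrable_fun.aestronglyMeasurable.aemeasurable
  have hpos := h.mul_measure_lt_rpow_le hΩ hΩv hp0 hK (a := r + a) (b := r + b) (by linarith)
    (hr.2.trans (measure_mono fun x (hx : f x ≤ r) => show f x ≤ r + a by linarith))
  have hneg := h.neg.mul_measure_lt_rpow_le hΩ hΩv hp0 hK (a := -r + a) (b := -r + b)
    (by linarith)
    (hr.1.trans (measure_mono fun x (hx : r ≤ f x) => show -f x ≤ -r + a by linarith))
  rw [← hμ] at hpos hneg
  rw [add_sub_add_left_eq_sub] at hpos hneg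
  simp only [Pi.neg_apply, enorm_neg] at hneg
  rw [Measure.smul_apply, withDensity_apply']
  have hsub : {x | b < |f x - r|} ⊆ {x | r + b < f x} ∪ {x | -r + b < -f x} := by
    intro x hx
    rcases lt_abs.1 (show b < |f x - r| from hx) with h1 | h1
    · left; show r + b < f x; linarith
    · right; show -r + b < -f x; linarith
  have hs2 : NullMeasurableSet {x | -r + a < -f x ∧ -f x ≤ -r + b} μ :=
    (nullMeasurableSet_lt aemeasurable_const hfm.neg).inter
      (nullMeasurableSet_le hfm.neg aemeasurable_const)
  have hdisj : Disjoint {x | r + a < f x ∧ f x ≤ r + b} {x | -r + a < -f x ∧ -f x ≤ -r + b} := by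
    rw [Set.disjoint_left]
    rintro x ⟨h1, -⟩ ⟨h2, -⟩
    linarith
  calc ENNReal.ofReal (b - a) * μ {x | b < |f x - r|} ^ (1 / p)
      ≤ ENNReal.ofReal (b - a) *
          (μ {x | r + b < f x} ^ (1 / p) + μ {x | -r + b < -f x} ^ (1 / p)) := by
        gcongr
        refine le_trans ?_ (ENNReal.rpow_add_le_add_rpow _ _ (by positivity)
          ((div_le_one hp0).2 hp))
        gcongr
        exact (measure_mono hsub).trans (measure_union_le _ _)
    _ ≤ 2 * K * ∫⁻ x in {x | r + a < f x ∧ f x ≤ r + b}, ‖g x‖ₑ ∂μ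
          + 2 * K * ∫⁻ x in {x | -r + a < -f x ∧ -f x ≤ -r + b}, ‖g x‖ₑ ∂μ := by
        rw [mul_add]; exact add_le_add hpos hneg
    _ = 2 * K * ∫⁻ x in {x | r + a < f x ∧ f x ≤ r + b} ∪
          {x | -r + a < -f x ∧ -f x ≤ -r + b}, ‖g x‖ₑ ∂μ := by
        rw [← mul_add, ← lintegral_add_measure,
          Measure.restrict_union₀ hdisj.aedisjoint hs2]
    _ ≤ 2 * K * ∫⁻ x in {x | a < |f x - r| ∧ |f x - r| ≤ b}, ‖g x‖ₑ ∂μ := by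
        gcongr
        rintro x (⟨h1, h2⟩ | ⟨h1, h2⟩)
        · show a < |f x - r| ∧ |f x - r| ≤ b
          rw [abs_of_nonneg (by linarith)]
          constructor <;> linarith
        · show a < |f x - r| ∧ |f x - r| ≤ b
          rw [abs_of_nonpos (by linarith)]
          constructor <;> linarith
    _ = _ := by
        rw [ENNReal.smul_def, smul_eq_mul]
        push_cast
        rfl

end Truncation

/-! ### Return to real integrals and proof of the theorem. -/

lemma integrableOn_and_integral_le_of_lintegral_le {u : ℝ → ℝ} {t X : ℝ} (ht : 0 ≤ t)
    (hm : AEStronglyMeasurable u (volume.restrict (Ioc 0 t))) (hu : ∀ s ∈ Ioc 0 t, 0 ≤ u s)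
    (hX : 0 ≤ X) (h : ∫⁻ s in Ioc 0 t, ENNReal.ofReal (u s) ≤ ENNReal.ofReal X) :
    IntegrableOn u (Ioc 0 t) ∧ ∫ s in (0 : ℝ)..t, u s ≤ X := by
  have hu' : 0 ≤ᵐ[volume.restrict (Ioc 0 t)] u :=
    (ae_restrict_iff' measurableSet_Ioc).2 (ae_of_all _ hu)
  have hi : IntegrableOn u (Ioc 0 t) :=
    ⟨hm, (hasFiniteIntegral_iff_ofReal hu').2 (h.trans_lt ENNReal.ofReal_lt_top)⟩
  refine ⟨hi, ?_⟩
  rw [intervalIntegral.integral_of_le ht]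
  rw [← ofReal_integral_eq_lintegral_ofReal hi hu'] at h
  exact (ENNReal.ofReal_le_ofReal_iff hX).1 h

lemma aestronglyMeasurable_maxRearr {α : Type*} [MeasurableSpace α] {μ : Measure α}
    [IsFiniteMeasure μ] {F : α → ℝ} (hF : Integrable F μ) {t : ℝ} (ht : 0 ≤ t) :
    AEStronglyMeasurable (maxRearr μ F) (volume.restrict (Ioc 0 t)) := by
  have h1 : ContinuousOn (fun s => ∫ u in (0 : ℝ)..s, decRearr μ F u) (uIcc 0 t) := by
    refine intervalIntegral.continuousOn_primitive_interval ?_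
    rw [uIcc_of_le ht, integrableOn_Icc_iff_integrableOn_Ioc]
    exact integrableOn_decRearr hF t
  rw [uIcc_of_le ht] at h1
  exact measurable_inv.aestronglyMeasurable.mul
    ((h1.mono Ioc_subset_Icc_self).aestronglyMeasurable measurableSet_Ioc)

theorem theorem3 {n : ℕ} (Ω : Set (EuclideanSpace ℝ (Fin n)))
    (hΩ : IsOpen Ω) (hΩc : IsConnected Ω) (hΩv : volume Ω = 1)
    (p : ℝ) (hp : 1 ≤ p) (hSP : SobolevPoincare Ω p) :
    ∃ C : ℝ, 0 < C ∧
      ∀ (f : EuclideanSpace ℝ (Fin n) → ℝ)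
        (g : EuclideanSpace ℝ (Fin n) → EuclideanSpace ℝ (Fin n)), SobolevW11 Ω f g →
      ∃ r : ℝ, IsMedian (volume.restrict Ω) f r ∧
        -- (a)
        (∀ᵐ s ∂(volume.restrict (Ioo (0 : ℝ) 1)),
          DifferentiableAt ℝ (decRearr (volume.restrict Ω) (fun x => f x - r)) s) ∧
        (∀ t ∈ Ioc (0 : ℝ) 1,
          IntegrableOn
            (fun s => s ^ (1 / p) * -deriv (decRearr (volume.restrict Ω) (fun x => f x - r)) s)
            (Ioc 0 t) ∧
          ∫ s in (0 : ℝ)..t,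
              s ^ (1 / p) * -deriv (decRearr (volume.restrict Ω) (fun x => f x - r)) s
            ≤ C * ∫ s in (0 : ℝ)..t, decRearr (volume.restrict Ω) (fun x => ‖g x‖) s) ∧
        -- (b)
        (∀ t ∈ Ioc (0 : ℝ) 1,
          t ^ (1 / p - 1) * (maxRearr (volume.restrict Ω) (fun x => f x - r) t
              - decRearr (volume.restrict Ω) (fun x => f x - r) t)
            ≤ C * (t⁻¹ * ∫ s in (0 : ℝ)..t, decRearr (volume.restrict Ω) (fun x => ‖g x‖) s)) ∧
        -- (c)
        (1 < p → ∀ t ∈ Ioc (0 : ℝ) 1,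
          IntegrableOn
            (fun s => s ^ (1 / p - 1) * (maxRearr (volume.restrict Ω) (fun x => f x - r) s
              - decRearr (volume.restrict Ω) (fun x => f x - r) s)) (Ioc 0 t) ∧
          ∫ s in (0 : ℝ)..t,
              s ^ (1 / p - 1) * (maxRearr (volume.restrict Ω) (fun x => f x - r) s
                - decRearr (volume.restrict Ω) (fun x => f x - r) s)
            ≤ C * ∫ s in (0 : ℝ)..t, decRearr (volume.restrict Ω) (fun x => ‖g x‖) s) := by

  obtain ⟨K, hK⟩ := hSP
  have hp0 : 0 < p := by linarith
  have hprob : IsProbabilityMeasure (volume.restrict Ω) := ⟨by simpa using hΩv⟩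
  set μ := volume.restrict Ω with hμ
  have hq : 0 ≤ p / (p - 1) := div_nonneg hp0.le (by linarith)
  have hK0 : (0 : ℝ) ≤ K := K.coe_nonneg
  -- C dominates 2K, needed for (a) and (b), and 2Kp/(p - 1), needed for (c); the added 1 keeps it
  -- positive if K = 0. For p = 1 the quotient is 0 by convention.
  set C : ℝ := (2 * K + 1) * (1 + p / (p - 1)) with hC
  have hC1 : 2 * K ≤ C := by rw [hC]; nlinarith
  have hC2 : p / (p - 1) * (2 * K) ≤ C := by rw [hC]; nlinarith
  refine ⟨C, by positivity, fun f g h => ?_⟩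
  have hfm : AEMeasurable f μ := h.integrable_fun.aestronglyMeasurable.aemeasurable
  obtain ⟨r, hr⟩ := exists_isMedian hfm
  have hF : Integrable (fun x => f x - r) μ := h.integrable_fun.sub (integrable_const r)
  have hFm := hF.aestronglyMeasurable.aemeasurable
  have hG : Integrable (fun x => ‖g x‖) μ := h.integrable_grad.norm
  have hW := h.weakTruncationBound hΩ hΩv hp hK hr
  rw [← hμ] at hW
  have hfin : IsFiniteMeasure (μ.withDensity fun x => ‖g x‖ₑ) :=
    isFiniteMeasure_withDensity h.integrable_grad.2.ne
  set ν : Measure (EuclideanSpace ℝ (Fin n)) := (2 * K) • μ.withDensity fun x => ‖g x‖ₑ with hν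
  have hνμ : ν ≪ μ := (Measure.smul_absolutelyContinuous).trans (withDensity_absolutelyContinuous _ _)
  have hFν : AEMeasurable (fun x => f x - r) ν := hFm.mono_ac hνμ
  set I : ℝ → ℝ := fun t => ∫ s in (0 : ℝ)..t, decRearr μ (fun x => ‖g x‖) s with hI
  have hI0 : ∀ t, 0 < t → 0 ≤ I t := fun t ht =>
    intervalIntegral.integral_nonneg ht.le fun s _ => decRearr_nonneg s
  have hνI : ∀ t, 0 < t → ν {x | decRearr μ (fun x => f x - r) t < |f x - r|}
      ≤ ENNReal.ofReal (2 * K * I t) := by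
    intro t ht
    -- Hardy–Littlewood for |∇f| on {|F| > F*(t)}, a set of measure at most t.
    have h1 := setLIntegral_le_lintegral_decRearr hG.aestronglyMeasurable.aemeasurable
      (measure_decRearr_lt_le hFm ht)
    simp only [abs_norm, ofReal_norm] at h1
    rw [← ofReal_integral_decRearr hG ht.le] at h1
    rw [hν, Measure.smul_apply, withDensity_apply', ENNReal.smul_def, smul_eq_mul,
      ENNReal.ofReal_mul (by positivity)]
    have h2 : ((2 * K : ℝ≥0) : ℝ≥0∞) = ENNReal.ofReal (2 * K) := by
      rw [← ENNReal.ofReal_coe_nnreal]; simp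
    rw [h2]
    gcongr
  refine ⟨r, hr, ?_, fun t ht => ?_, fun t ht => ?_, fun hp1 t ht => ?_⟩
  · exact (ae_restrict_iff' measurableSet_Ioo).2 (ae_differentiableAt_decRearr hFm 1)
  · have hX : 0 ≤ 2 * K * I t := mul_nonneg (by positivity) (hI0 t ht.1)
    obtain ⟨h1, h2⟩ := integrableOn_and_integral_le_of_lintegral_le
      (u := fun s => s ^ (1 / p) * -deriv (decRearr μ (fun x => f x - r)) s) ht.1.le
      ((measurable_id.pow_const _).mul (measurable_deriv _).neg).aestronglyMeasurable
      (fun s hs => mul_nonneg (Real.rpow_nonneg hs.1.le _)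
        (neg_nonneg.2 (deriv_decRearr_nonpos hFm hs.1))) hX
      ((hW.lintegral_rpow_mul_deriv_le hp0 hFm hFν ht.1).trans (hνI t ht.1))
    exact ⟨h1, h2.trans (mul_le_mul_of_nonneg_right hC1 (hI0 t ht.1))⟩
  · have h1 := (hW.mul_maxRearr_sub_le hp hF hFν ht.1).trans
      (mul_le_mul_right (hνI t ht.1) _)
    have hX : 0 ≤ t ^ (1 - 1 / p) * (2 * K * I t) :=
      mul_nonneg (Real.rpow_nonneg ht.1.le _) (mul_nonneg (by positivity) (hI0 t ht.1))
    rw [← ENNReal.ofReal_mul (Real.rpow_nonneg ht.1.le _), ENNReal.ofReal_le_ofReal_iff hX] at h1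
    set Q := maxRearr μ (fun x => f x - r) t - decRearr μ (fun x => f x - r) t with hQ
    calc t ^ (1 / p - 1) * Q = t ^ (1 / p - 1) * t⁻¹ * (t * Q) := by
          have := ht.1.ne'
          field_simp
      _ ≤ t ^ (1 / p - 1) * t⁻¹ * (t ^ (1 - 1 / p) * (2 * K * I t)) :=
          mul_le_mul_of_nonneg_left h1
            (mul_nonneg (Real.rpow_nonneg ht.1.le _) (inv_nonneg.2 ht.1.le))
      _ = t ^ (1 / p - 1) * t ^ (1 - 1 / p) * (2 * K * (t⁻¹ * I t)) := by ring
      _ = 2 * K * (t⁻¹ * I t) := by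
          rw [← Real.rpow_add ht.1]; simp
      _ ≤ C * (t⁻¹ * I t) :=
          mul_le_mul_of_nonneg_right hC1 (mul_nonneg (inv_nonneg.2 ht.1.le) (hI0 t ht.1))
  · have hX : 0 ≤ p / (p - 1) * (2 * K * I t) :=
      mul_nonneg hq (mul_nonneg (by positivity) (hI0 t ht.1))
    obtain ⟨h1, h2⟩ := integrableOn_and_integral_le_of_lintegral_le
      (u := fun s => s ^ (1 / p - 1) * (maxRearr μ (fun x => f x - r) s
        - decRearr μ (fun x => f x - r) s)) ht.1.le
      ((measurable_id.pow_const _).aestronglyMeasurable.mul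
        ((aestronglyMeasurable_maxRearr hF ht.1.le).sub
          (aemeasurable_decRearr hFm t).aestronglyMeasurable))
      (fun s hs => mul_nonneg (Real.rpow_nonneg hs.1.le _)
        (sub_nonneg.2 (decRearr_le_maxRearr hF hs.1))) hX
      ((hW.lintegral_rpow_mul_maxRearr_sub_le hp1 hF hFν ht.1).trans
        ((mul_le_mul_right (hνI t ht.1) _).trans_eq (ENNReal.ofReal_mul hq).symm))
    refine ⟨h1, h2.trans ?_⟩
    rw [← mul_assoc]
    exact mul_le_mul_of_nonneg_right hC2 (hI0 t ht.1)
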